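/- **Setting.** Let $M\ge 2$ and $T_c\ge 1$ be integers. A transmitter with $M$ antennas serves two single-antenna users. In time slot $t=1,2,\dots$ it sends $x_t\in\mathbb C^M$ with $\mathbb E\|x_t\|^2\le P$, and user $i\in\{1,2\}$ receives $y^{(i)}_t=(h^{(i)}_t)^{\mathsf T}x_t+z^{(i)}_t$, where the noise samples $z^{(i)}_t$ are i.i.d. circularly symmetric complex Gaussian of unit power, independent of everything else. The random channel vectors $h^{(i)}_t$ have mean zero and identity covariance, $h^{(1)}_t,h^{(2)}_t$ are almost surely linearly independent, and the channels are constant on each coherence period $\{\ell T_c+1,\dots,(\ell+1)T_c\}$, $\ell\ge 0$ (they may otherwise be correlated over time). For each power $P$ there is a feedback process: $\hat h^{(i)}_{t,t'}$ is the estimate of $h^{(i)}_t$ available to the transmitter at time $t'$. The entries of each error $h^{(i)}_t-\hat h^{(i)}_{t,t'}$ are i.i.d. zero-mean circularly symmetric complex Gaussian, and the current error $h^{(i)}_t-\hat h^{(i)}_{t,t}$ is independent of all estimates available up to time $t$. The current quality exponents $\alpha^{(i)}_t=-\lim_{P\to\infty}\log\mathbb E\|h^{(i)}_t-\hat h^{(i)}_{t,t}\|^2/\log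 P$ are assumed to exist, to be $T_c$-periodic in $t$, and to satisfy $0\le\alpha^{(i)}_1\le\dots\le\alpha^{(i)}_{T_c}\le 1$; put $\bar\alpha^{(i)}=\frac1{T_c}\sum_{t=1}^{T_c}\alpha^{(i)}_t$. The delayed quality exponent of user $i$ is the number $\beta^{(i)}$ (when it exists) such that, for all sufficiently large finite $\eta$ and all $t$, $\beta^{(i)}=-\lim_{P\to\infty}\log\mathbb E\|h^{(i)}_t-\hat h^{(i)}_{t,t+\eta}\|^2/\log P$. **Achievability.** In a code of duration $n$, $x_t$ is a function of the two messages and of the estimates available up to time $t$, and each receiver decodes its message from its $n$ received symbols, knowing all channels and all estimates. A pair $(d_1,d_2)$ is an achievable DoF pair if for every $\varepsilon>0$ and every sufficiently large $n$ there are codes of duration $n$, one for each power $P$, whose rates satisfy $\lim_{P\to\infty}R_i/\log P\ge d_i-\varepsilon$ for $i=1,2$ and whose error probability (for uniform messages) tends to $0$ as $P\to\infty$. **Statement.** Let $d\ge 0$ and suppose $\bar\alpha^{(i)}\ge 3d-2$ for $i=1,2$. 1. If the delayed quality exponents $\beta^{(i)}$ exist, with $\alpha^{(i)}_{T_c}\le\beta^{(i)}\le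 1$, and $\beta^{(i)}\ge 2d-1$ for $i=1,2$, then the symmetric DoF pair $(d,d)$ is achievable. 2. If $\alpha^{(i)}_{T_c}\ge 2d-1$ for $i=1,2$, then $(d,d)$ is achievable with no feedback after the coherence period, that is, with every estimate $\hat h^{(i)}_{t,t'}$ for which $t'$ lies after the end $\ell T_c$ of the coherence period containing $t$ replaced by $\hat h^{(i)}_{t,\ell T_c}$. In the case of symmetric feedback ($\alpha^{(1)}_t=\alpha^{(2)}_t=\alpha_t$, $\beta^{(1)}=\beta^{(2)}=\beta$) the conditions are $\bar\alpha\ge 3d-2$ with $\beta\ge 2d-1$, respectively $\bar\alpha\ge 3d-2$ with $\alpha_{T_c}\ge 2d-1$. -/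

import Mathlib

open MeasureTheory ProbabilityTheory Filter Topology

noncomputable section

namespace MisoBC

/-- Vectors over the `M` transmit antennas, with the Euclidean norm. -/
abbrev Vec (M : ℕ) : Type := EuclideanSpace ℂ (Fin M)

/-- The circularly symmetric complex Gaussian law of mean `0` and variance `v`: the real and the
imaginary part are independent real Gaussians of variance `v / 2`. -/
def complexGaussian (v : NNReal) : Measure ℂ :=
  ((gaussianReal 0 (v / 2)).prod (gaussianReal 0 (v / 2))).map
    (fun p : ℝ × ℝ => (p.1 : ℂ) + (p.2 : ℂ) * Complex.I)

instance (v : NNReal) : IsProbabilityMeasure (complexGaussian v) :=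
  Measure.isProbabilityMeasure_map (by fun_prop)

/-- A fading process of the two users: `h t i ω` is the channel of user `i` in time slot `t`.
Time slots are numbered `0, 1, 2, …`. -/
abbrev Channel (Ω : Type*) (M : ℕ) : Type _ := ℕ → Fin 2 → Ω → Vec M

/-- A feedback process: `est P t t' i ω` is the estimate, available to the transmitter from time
slot `t'` on, of the channel of user `i` in time slot `t`, when the transmit power is `P`. -/
abbrev Feedback (Ω : Type*) (M : ℕ) : Type _ := ℝ → ℕ → ℕ → Fin 2 → Ω → Vec M

/-- The unconjugated product `hᵀ x`. -/
def dotT {M : ℕ} (h x : Vec M) : ℂ := ∑ m, h m * x m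

section Quality

variable {Ω : Type*} [MeasurableSpace Ω] {M : ℕ}

/-- The mean squared error of the estimate of the slot-`t` channel that is available at `t'`. -/
def mse (μ : Measure Ω) (h : Channel Ω M) (est : Feedback Ω M) (P : ℝ) (t t' : ℕ) (i : Fin 2) :
    ℝ :=
  ∫ ω, ‖h t i ω - est P t t' i ω‖ ^ 2 ∂μ

/-- `a = - lim_{P → ∞} log (f P) / log P`, for an eventually positive `f`. -/
def HasQualityExponent (f : ℝ → ℝ) (a : ℝ) : Prop :=
  (∀ᶠ P in atTop, 0 < f P) ∧
    Tendsto (fun P => -(Real.log (f P) / Real.log P)) atTop (𝓝 a)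

/-- `b` is the delayed quality exponent of user `i`, for every time slot: the exponent of the
estimates that arrive `η` slots after the channel, for all sufficiently large finite `η`. -/
def HasDelayedExponent (μ : Measure Ω) (h : Channel Ω M) (est : Feedback Ω M) (i : Fin 2)
    (b : ℝ) : Prop :=
  ∃ η₀ : ℕ, ∀ η, η₀ ≤ η → ∀ t, HasQualityExponent (fun P => mse μ h est P t (t + η) i) b

/-- The feedback process in which no feedback about a channel arrives after the end of its coherence
period: from then on, its estimate stays the one held in the last slot of that period. -/
def stopAfterCoherence (Tc : ℕ) (est : Feedback Ω M) : Feedback Ω M :=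
  fun P t t' i => est P t (min t' (t / Tc * Tc + (Tc - 1))) i

/-- The periodically evolving setting with coherence period `Tc` and current quality exponents
`α i t` (user `i`, slot `t`). The coherence periods are the slots
`ℓ * Tc, …, ℓ * Tc + (Tc - 1)`. -/
structure PeriodicallyEvolving (μ : Measure Ω) (Tc : ℕ) (h : Channel Ω M) (est : Feedback Ω M)
    (α : Fin 2 → ℕ → ℝ) : Prop where
  measurable_channel : ∀ t i, Measurable (h t i)
  measurable_estimate : ∀ P t t' i, Measurable (est P t t' i)
  square_integrable : ∀ t i, MemLp (h t i) 2 μ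
  mean_zero : ∀ t i m, ∫ ω, h t i ω m ∂μ = 0
  covariance_one : ∀ t i m m',
    ∫ ω, h t i ω m * (starRingEnd ℂ) (h t i ω m') ∂μ = if m = m' then 1 else 0
  linearIndependent : ∀ t, ∀ᵐ ω ∂μ, LinearIndependent ℂ (fun i : Fin 2 => h t i ω)
  /-- the channels do not change during a coherence period -/
  block_fading : ∀ t t' i, t / Tc = t' / Tc → h t i =ᵐ[μ] h t' i
  /-- the entries of every estimation error are i.i.d. circularly symmetric complex Gaussian -/
  gaussian_error : ∀ P, 0 < P → ∀ t t' i,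
    (∃ v : NNReal, ∀ m, μ.map (fun ω => (h t i ω - est P t t' i ω) m) = complexGaussian v) ∧
      iIndepFun (fun m ω => (h t i ω - est P t t' i ω) m) μ
  /-- the current estimation error is independent of all estimates available so far -/
  error_independent : ∀ P, 0 < P → ∀ t i,
    IndepFun (fun ω => h t i ω - est P t t i ω)
      (fun ω (s : ℕ) (t' : Set.Iic t) (j : Fin 2) => est P s t' j ω) μ
  current_exponent : ∀ t i, HasQualityExponent (fun P => mse μ h est P t t i) (α i t)
  periodic : ∀ i t, α i (t + Tc) = α i t
  exponent_nonneg : ∀ i t, 0 ≤ α i t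
  exponent_le_one : ∀ i t, α i t ≤ 1
  /-- the feedback accumulates during the coherence period -/
  exponent_mono : ∀ i s t, s ≤ t → t < Tc → α i s ≤ α i t

end Quality

/-- A code for two users over `n` channel uses. Message `i`, for user `i`, has `size i` values.
The transmitter sees, in slot `t`, the estimates (of any channel) available up to slot `t`. Receiver
`i` sees its `n` received symbols, all the channels of both users and all the estimates. -/
structure Code (M n : ℕ) where
  size : Fin 2 → ℕ
  size_pos : ∀ i, 0 < size i
  enc : Fin n → ((i : Fin 2) → Fin (size i)) → (Fin n → Fin n → Fin 2 → Vec M) → Vec M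
  enc_measurable : ∀ t w, Measurable (enc t w)
  enc_causal : ∀ t w e e', (∀ s t' i, t' ≤ t → e s t' i = e' s t' i) → enc t w e = enc t w e'
  dec : (i : Fin 2) →
    (Fin n → ℂ) × (Fin n → Fin 2 → Vec M) × (Fin n → Fin n → Fin 2 → Vec M) → Fin (size i)
  dec_measurable : ∀ i, Measurable (dec i)

namespace Code

variable {Ω : Type*} [MeasurableSpace Ω] {M n : ℕ}

/-- The channels of the first `n` slots. -/
def channels (h : Channel Ω M) (ω : Ω) : Fin n → Fin 2 → Vec M := fun t i => h t i ω

/-- The estimates, exchanged during the first `n` slots, of the channels of these slots. -/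
def estimates (est : Feedback Ω M) (P : ℝ) (ω : Ω) : Fin n → Fin n → Fin 2 → Vec M :=
  fun t t' i => est P t t' i ω

/-- The transmitted vector of slot `t` for the messages `w`. -/
def input (C : Code M n) (est : Feedback Ω M) (P : ℝ) (w : (i : Fin 2) → Fin (C.size i))
    (t : Fin n) (ω : Ω) : Vec M :=
  C.enc t w (estimates est P ω)

/-- The received symbols `hᵀ x + z` of user `i`, where `z` are the noise samples. -/
def output (C : Code M n) (h : Channel Ω M) (est : Feedback Ω M) (P : ℝ)
    (w : (i : Fin 2) → Fin (C.size i)) (i : Fin 2) (ω : Ω) (z : Fin 2 × Fin n → ℂ) : Fin n → ℂ :=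
  fun t => dotT (h t i ω) (C.input est P w t ω) + z (i, t)

/-- The power constraint `E ‖x_t‖² ≤ P` in every slot, for uniformly distributed messages. -/
def PowerConstraint (C : Code M n) (μ : Measure Ω) (est : Feedback Ω M) (P : ℝ) : Prop :=
  ∀ t : Fin n, (∑ w : ((i : Fin 2) → Fin (C.size i)), ∫⁻ ω, ‖C.input est P w t ω‖ₑ ^ 2 ∂μ) /
    ((C.size 0 * C.size 1 : ℕ) : ENNReal) ≤ ENNReal.ofReal P

/-- The probability that some user decodes its message wrongly, for uniformly distributed messages.
The noise samples are i.i.d. complex Gaussian of unit power, and independent of the channels,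
the estimates and the messages. -/
def errorProb (C : Code M n) (μ : Measure Ω) (h : Channel Ω M) (est : Feedback Ω M) (P : ℝ) :
    ENNReal :=
  (∑ w : ((i : Fin 2) → Fin (C.size i)),
    (μ.prod (Measure.pi (fun _ : Fin 2 × Fin n => complexGaussian 1)))
      {p | ∃ i, C.dec i (C.output h est P w i p.1 p.2, channels h p.1, estimates est P p.1) ≠ w i}) /
    ((C.size 0 * C.size 1 : ℕ) : ENNReal)

/-- The rate of user `i`, in bits per channel use. -/
def rate (C : Code M n) (i : Fin 2) : ℝ := Real.logb 2 (C.size i) / n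

end Code

/-- The pair `(d 0, d 1)` of degrees of freedom is achievable. The regime is that of a large duration
`n` and of a power `P` much larger than `n`: up to any `ε > 0`, for all sufficiently long
durations `n` there are codes `C P` of duration `n`, one for each power, that satisfy the power
constraint, have `lim R_i / log P` at least `d i - ε`, and have an error probability that vanishes
as `P → ∞`. -/
def AchievableDoF {Ω : Type*} [MeasurableSpace Ω] {M : ℕ} (μ : Measure Ω) (h : Channel Ω M)
    (est : Feedback Ω M) (d : Fin 2 → ℝ) : Prop :=
  ∀ ε : ℝ, 0 < ε → ∃ n₀ : ℕ, ∀ n, n₀ ≤ n → ∃ C : ℝ → Code M n,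
    (∀ P, 0 < P → (C P).PowerConstraint μ est P) ∧
    (∀ i, ∃ r : ℝ, d i - ε ≤ r ∧
      Tendsto (fun P => (C P).rate i / Real.logb 2 P) atTop (𝓝 r)) ∧
    Tendsto (fun P => (C P).errorProb μ h est P) atTop (𝓝 0)

end MisoBC

end

/-!
The scheme is block-Markov. In every slot each user gets two private symbols: one is zero-forced at
the other user with the current estimate, the other is sent on a generic beam. What is left of the
private signal of one user at the other one is its disturbance, and it consists, for `D` digits of
private signal and `a` digits of zero-forcing gain, of `D - a` digits per symbol. The transmitter
computes the disturbances of a block from the delayed estimates, quantises them and sends them some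
blocks later, together with fresh digits, as common symbols above the level of the private signals.
The receivers decode backwards, from the last block on: the common symbols of later blocks reveal
the disturbances, and hence two equations for the two private symbols in every slot.

Integer digits in the radix `R = P ^ (1 / (2 N))` take the place of Gaussian codebooks. Decoding
then is deterministic as soon as the channels, the noise and the estimation errors are within
suitable powers of `R`, which holds with probability tending to one, and every guard digit costs
only `1 / N` degrees of freedom.
-/

noncomputable section

namespace MisoBC

/-! ### The unconjugated product -/

section Product

variable {M : ℕ}

/-- The entrywise conjugate of a vector. It turns the unconjugated product into the inner product of
Mathlib, which is conjugate-linear in its first argument. -/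
def conjVec (g : Vec M) : Vec M := WithLp.toLp 2 fun m => (starRingEnd ℂ) (g m)

@[simp]
theorem conjVec_apply (g : Vec M) (m : Fin M) : conjVec g m = (starRingEnd ℂ) (g m) := rfl

@[simp]
theorem norm_conjVec (g : Vec M) : ‖conjVec g‖ = ‖g‖ := by
  simp [EuclideanSpace.norm_eq]

theorem conjVec_sub (g k : Vec M) : conjVec (g - k) = conjVec g - conjVec k := by
  ext m; simp

theorem measurable_conjVec : Measurable (conjVec : Vec M → Vec M) := by
  have : Continuous (conjVec : Vec M → Vec M) :=
    (PiLp.continuous_toLp 2 _).comp (by fun_prop)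
  exact this.measurable

theorem dotT_eq_inner (g x : Vec M) : dotT g x = inner ℂ (conjVec g) x := by
  simp [dotT, PiLp.inner_apply, mul_comm]

theorem dotT_comm (g x : Vec M) : dotT g x = dotT x g := by
  simp [dotT, mul_comm]

theorem dotT_add (g x y : Vec M) : dotT g (x + y) = dotT g x + dotT g y := by
  simp [dotT_eq_inner]

theorem dotT_sub (g x y : Vec M) : dotT g (x - y) = dotT g x - dotT g y := by
  simp [dotT_eq_inner]

theorem dotT_smul (g : Vec M) (c : ℂ) (x : Vec M) : dotT g (c • x) = c * dotT g x := by
  simp [dotT_eq_inner]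

theorem sub_dotT (g k x : Vec M) : dotT (g - k) x = dotT g x - dotT k x := by
  simp [dotT_comm _ x, dotT_sub]

theorem smul_dotT (c : ℂ) (g x : Vec M) : dotT (c • g) x = c * dotT g x := by
  simp [dotT_comm _ x, dotT_smul]

theorem norm_dotT_le (g x : Vec M) : ‖dotT g x‖ ≤ ‖g‖ * ‖x‖ := by
  simpa [dotT_eq_inner] using norm_inner_le_norm (𝕜 := ℂ) (conjVec g) x

@[fun_prop]
theorem measurable_dotT {X : Type*} [MeasurableSpace X] {f g : X → Vec M}
    (hf : Measurable f) (hg : Measurable g) : Measurable fun x => dotT (f x) (g x) := by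
  unfold dotT; fun_prop

end Product

/-! ### Events of high probability -/

/-- The event `A P` has probability tending to one as `P → ∞`. The measure need not be defined on
the events, so this is stated as the complements having vanishing outer measure. -/
def WithHighProb {Ω : Type*} [MeasurableSpace Ω] (μ : Measure Ω) (A : ℝ → Ω → Prop) : Prop :=
  Tendsto (fun P => μ {ω | ¬ A P ω}) atTop (𝓝 0)

namespace WithHighProb

variable {Ω : Type*} [MeasurableSpace Ω] {μ : Measure Ω}

theorem forall_finite {ι : Type*} [Finite ι] {A : ι → ℝ → Ω → Prop}
    (hA : ∀ k, WithHighProb μ (A k)) : WithHighProb μ fun P ω => ∀ k, A k P ω := by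
  have := Fintype.ofFinite ι
  have h := tendsto_finsetSum Finset.univ fun k _ => hA k
  rw [Finset.sum_const_zero] at h
  refine tendsto_of_tendsto_of_tendsto_of_le_of_le tendsto_const_nhds h (fun _ => zero_le)
    fun P => (measure_mono fun ω hω => ?_).trans
      (measure_iUnion_fintype_le μ fun k => {ω | ¬ A k P ω})
  exact Set.mem_iUnion.2 (not_forall.1 hω)

theorem and {A B : ℝ → Ω → Prop} (hA : WithHighProb μ A) (hB : WithHighProb μ B) :
    WithHighProb μ fun P ω => A P ω ∧ B P ω := by
  simpa only [Bool.forall_bool, cond_false, cond_true] using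
    forall_finite (A := fun k => cond k B A) (by simp [hA, hB])

theorem mono {A B : ℝ → Ω → Prop} (hA : WithHighProb μ A) (hAB : ∀ P ω, A P ω → B P ω) :
    WithHighProb μ B :=
  tendsto_of_tendsto_of_tendsto_of_le_of_le tendsto_const_nhds hA (fun _ => zero_le)
    fun P => measure_mono fun ω hω hP => hω (hAB P ω hP)

theorem or_of_not {p : Prop} {A : ℝ → Ω → Prop} (hA : ¬ p → WithHighProb μ A) :
    WithHighProb μ fun P ω => p ∨ A P ω := by
  by_cases hp : p
  · simp [WithHighProb, hp]
  · simpa [WithHighProb, hp] using hA hp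

variable [IsFiniteMeasure μ] {R : ℝ → ℝ}

theorem le_of_tendsto_atTop (hR : Tendsto R atTop atTop) {f : Ω → ℝ} (hf : Measurable f) :
    WithHighProb μ fun P ω => f ω ≤ R P := by
  have hempty : (⋂ r : ℝ, {x | r < f x}) = ∅ :=
    Set.eq_empty_of_forall_notMem fun x hx => lt_irrefl (f x) (Set.mem_iInter.1 hx (f x))
  have h := tendsto_measure_iInter_atTop (μ := μ) (s := fun r : ℝ => {x | r < f x})
    (fun r => (measurableSet_lt measurable_const hf).nullMeasurableSet)
    (fun r r' hr x hx => lt_of_le_of_lt hr hx) ⟨0, measure_ne_top _ _⟩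
  rw [hempty, measure_empty] at h
  simpa only [WithHighProb, not_le, Function.comp_def] using h.comp hR

theorem le_mul_norm (hR : Tendsto R atTop atTop) {f : Ω → ℂ} (hf : Measurable f)
    (h0 : ∀ᵐ ω ∂μ, f ω ≠ 0) (c : ℝ) : WithHighProb μ fun P ω => c ≤ R P * ‖f ω‖ := by
  have h := le_of_tendsto_atTop (μ := μ) hR (hf.norm.inv.const_mul c)
  refine tendsto_of_tendsto_of_tendsto_of_le_of_le tendsto_const_nhds h (fun _ => zero_le)
    fun P => measure_mono_ae ?_
  filter_upwards [h0] with ω hω hlt hle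
  refine hlt ?_
  rwa [Pi.inv_apply, ← div_eq_mul_inv, div_le_iff₀ (norm_pos_iff.2 hω)] at hle

end WithHighProb

/-! ### The radix -/

/-- The radix `P ^ (1 / (2 N))`: an amplitude of `N` digits in this radix has power `P`, and each
digit is worth `1 / N` of a degree of freedom. -/
def radix (N : ℕ) (P : ℝ) : ℝ := P ^ (1 / (2 * (N : ℝ)))

section Radix

variable {N : ℕ} {P : ℝ}

theorem radix_pow (hP : 0 ≤ P) (k : ℕ) : radix N P ^ k = P ^ ((k : ℝ) / (2 * N)) := by
  rw [radix, ← Real.rpow_natCast, ← Real.rpow_mul hP]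
  congr 1; ring

theorem radix_pow_sq (hN : 0 < N) (hP : 0 ≤ P) : (radix N P ^ N) ^ 2 = P := by
  have hN' : (N : ℝ) ≠ 0 := by positivity
  have h : ((N * 2 : ℕ) : ℝ) / (2 * N) = 1 := by push_cast; field_simp
  rw [← pow_mul, radix_pow hP, h, Real.rpow_one]

theorem tendsto_radix (hN : 0 < N) : Tendsto (radix N) atTop atTop :=
  tendsto_rpow_atTop (by positivity)

end Radix

theorem HasQualityExponent.eventually_le_rpow {f : ℝ → ℝ} {a b : ℝ} (hf : HasQualityExponent f a)
    (hb : b < a) : ∀ᶠ P in atTop, f P ≤ P ^ (-b) := by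
  filter_upwards [hf.1, hf.2.eventually (lt_mem_nhds hb), eventually_gt_atTop 1] with P hpos hlt hP
  have hP0 : 0 < P := one_pos.trans hP
  rw [← Real.log_le_log_iff hpos (Real.rpow_pos_of_pos hP0 _), Real.log_rpow hP0,
    ← div_le_iff₀ (Real.log_pos hP)]
  linarith

theorem HasQualityExponent.withHighProb_norm_mul_radix_pow_le {Ω : Type*} [MeasurableSpace Ω]
    {μ : Measure Ω} {M N : ℕ} (hN : 0 < N) {e : ℝ → Ω → Vec M} {a : ℝ}
    (he : HasQualityExponent (fun P => ∫ ω, ‖e P ω‖ ^ 2 ∂μ) a) {m : ℕ} (hm : (m : ℝ) < N * a) :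
    WithHighProb μ fun P ω => ‖e P ω‖ * radix N P ^ m ≤ 1 := by
  have hN' : (0 : ℝ) < N := by exact_mod_cast hN
  obtain ⟨b, hmb, hba⟩ := exists_between ((div_lt_iff₀' hN').2 hm)
  have hlim : Tendsto (fun P : ℝ => ENNReal.ofReal (P ^ (-(b - (m : ℝ) / N)))) atTop (𝓝 0) := by
    simpa using ENNReal.tendsto_ofReal (tendsto_rpow_neg_atTop (sub_pos.2 hmb))
  refine tendsto_of_tendsto_of_tendsto_of_le_of_le' tendsto_const_nhds hlim
    (Eventually.of_forall fun _ => zero_le) ?_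
  filter_upwards [he.1, he.eventually_le_rpow hba, eventually_gt_atTop 0] with P hpos hmse hP
  have hint : Integrable (fun ω => ‖e P ω‖ ^ 2) μ := Integrable.of_integral_ne_zero hpos.ne'
  have hthreshold : (radix N P ^ m) ^ 2 = P ^ ((m : ℝ) / N) := by
    rw [← pow_mul, radix_pow hP.le]
    congr 1; push_cast; field_simp
  have hsub : {ω | ¬ ‖e P ω‖ * radix N P ^ m ≤ 1} ⊆
      {ω | 1 ≤ ENNReal.ofReal (‖e P ω‖ ^ 2 * P ^ ((m : ℝ) / N))} := fun ω hω => by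
    rw [Set.mem_ofPred_eq, ENNReal.one_le_ofReal, ← hthreshold, ← mul_pow]
    exact one_le_pow₀ (not_le.1 hω).le
  calc μ {ω | ¬ ‖e P ω‖ * radix N P ^ m ≤ 1}
      ≤ ∫⁻ ω, ENNReal.ofReal (‖e P ω‖ ^ 2 * P ^ ((m : ℝ) / N)) ∂μ := by
        refine (measure_mono hsub).trans ?_
        simpa using meas_ge_le_lintegral_div (hint.mul_const _).aemeasurable.ennreal_ofReal
          one_ne_zero ENNReal.one_ne_top
    _ = ENNReal.ofReal ((∫ ω, ‖e P ω‖ ^ 2 ∂μ) * P ^ ((m : ℝ) / N)) := by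
        rw [← ofReal_integral_eq_lintegral_ofReal (hint.mul_const _)
          (Eventually.of_forall fun ω => by positivity), integral_mul_const]
    _ ≤ ENNReal.ofReal (P ^ (-(b - (m : ℝ) / N))) := by
        refine ENNReal.ofReal_le_ofReal ?_
        rw [neg_sub, sub_eq_neg_add, Real.rpow_add hP]
        gcongr

/-! ### Zero forcing -/

section ZeroForcing

variable {M : ℕ}

/-- The beam `b` with its component along the conjugate of `g` removed, so that it is not received
over the channel `g`. It is scaled by `‖g‖ ^ 2` to make it polynomial in `g`. -/
def zeroForce (b g : Vec M) : Vec M := ((‖g‖ ^ 2 : ℝ) : ℂ) • b - dotT g b • conjVec g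

theorem dotT_conjVec_self (g : Vec M) : dotT g (conjVec g) = ((‖g‖ ^ 2 : ℝ) : ℂ) := by
  rw [dotT_eq_inner, inner_self_eq_norm_sq_to_K, norm_conjVec]; simp

theorem dotT_zeroForce_self (b g : Vec M) : dotT g (zeroForce b g) = 0 := by
  rw [zeroForce, dotT_sub, dotT_smul, dotT_smul, dotT_conjVec_self]; ring

theorem dotT_zeroForce (h b g : Vec M) :
    dotT h (zeroForce b g) = dotT (((‖g‖ ^ 2 : ℝ) : ℂ) • h - dotT h (conjVec g) • g) b := by
  rw [zeroForce, dotT_sub, dotT_smul, dotT_smul, sub_dotT, smul_dotT, smul_dotT]; ring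

theorem measurable_zeroForce (b : Vec M) : Measurable (zeroForce b) := by
  have hdot : Measurable fun g : Vec M => dotT g b := by fun_prop
  have hnorm : Measurable fun g : Vec M => ((‖g‖ ^ 2 : ℝ) : ℂ) := by fun_prop
  exact (hnorm.smul_const b).sub (hdot.smul measurable_conjVec)

theorem norm_zeroForce_le (b g : Vec M) : ‖zeroForce b g‖ ≤ 2 * ‖g‖ ^ 2 * ‖b‖ := by
  refine (norm_sub_le _ _).trans ?_
  rw [norm_smul, norm_smul, norm_conjVec, Complex.norm_real, Real.norm_of_nonneg (by positivity)]
  have := mul_le_mul_of_nonneg_right (norm_dotT_le g b) (norm_nonneg g)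
  nlinarith

theorem norm_zeroForce_sub_le (b g k : Vec M) :
    ‖zeroForce b g - zeroForce b k‖ ≤ 2 * ‖b‖ * (‖g‖ + ‖k‖) * ‖g - k‖ := by
  have hsub : zeroForce b g - zeroForce b k = ((‖g‖ ^ 2 - ‖k‖ ^ 2 : ℝ) : ℂ) • b -
      (dotT (g - k) b • conjVec g + dotT k b • conjVec (g - k)) := by
    simp only [zeroForce, sub_dotT, conjVec_sub, Complex.ofReal_sub, smul_sub, sub_smul]
    abel
  have hscale : ‖((‖g‖ ^ 2 - ‖k‖ ^ 2 : ℝ) : ℂ) • b‖ ≤ ‖g - k‖ * (‖g‖ + ‖k‖) * ‖b‖ := by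
    rw [norm_smul, Complex.norm_real, Real.norm_eq_abs, sq_sub_sq, abs_mul,
      abs_of_nonneg (by positivity : 0 ≤ ‖g‖ + ‖k‖), mul_comm (‖g‖ + ‖k‖)]
    gcongr
    exact abs_norm_sub_norm_le g k
  have hproj : ‖dotT (g - k) b • conjVec g + dotT k b • conjVec (g - k)‖ ≤
      ‖g - k‖ * ‖b‖ * ‖g‖ + ‖k‖ * ‖b‖ * ‖g - k‖ := by
    refine (norm_add_le _ _).trans ?_
    rw [norm_smul, norm_smul, norm_conjVec, norm_conjVec]
    gcongr <;> exact norm_dotT_le _ _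
  rw [hsub]
  linarith [norm_sub_le (((‖g‖ ^ 2 - ‖k‖ ^ 2 : ℝ) : ℂ) • b)
    (dotT (g - k) b • conjVec g + dotT k b • conjVec (g - k))]

/-- The determinant of the matrix of the coefficients with which the beams `b` and `u` are received
over the channels `h` and `k`. If it does not vanish, these two channels determine the symbols sent
on the two beams. -/
def beamDet (h k b u : Vec M) : ℂ := dotT h b * dotT k u - dotT h u * dotT k b

theorem beamDet_eq_dotT (h k b u : Vec M) :
    beamDet h k b u = dotT (dotT k u • h - dotT h u • k) b := by
  rw [beamDet, sub_dotT, smul_dotT, smul_dotT]; ring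

theorem beamDet_zeroForce (h k b u : Vec M) :
    beamDet h k (zeroForce b k) u = dotT h (zeroForce b k) * dotT k u := by
  rw [beamDet, dotT_zeroForce_self, mul_zero, sub_zero]

theorem measurable_beamDet {X : Type*} [MeasurableSpace X] {h k b : X → Vec M}
    (hh : Measurable h) (hk : Measurable k) (hb : Measurable b) (u : Vec M) :
    Measurable fun x => beamDet (h x) (k x) (b x) u := by
  unfold beamDet; fun_prop

theorem norm_beamDet_sub_le (h k b b' u : Vec M) :
    ‖beamDet h k b u - beamDet h k b' u‖ ≤ 2 * ‖h‖ * ‖k‖ * ‖u‖ * ‖b - b'‖ := by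
  have hsub : beamDet h k b u - beamDet h k b' u =
      dotT h (b - b') * dotT k u - dotT h u * dotT k (b - b') := by
    simp only [beamDet, dotT_sub]; ring
  calc ‖beamDet h k b u - beamDet h k b' u‖
      ≤ ‖dotT h (b - b')‖ * ‖dotT k u‖ + ‖dotT h u‖ * ‖dotT k (b - b')‖ := by
        rw [hsub, ← norm_mul, ← norm_mul]; exact norm_sub_le _ _
    _ ≤ (‖h‖ * ‖b - b'‖) * (‖k‖ * ‖u‖) + (‖h‖ * ‖u‖) * (‖k‖ * ‖b - b'‖) := by
        gcongr <;> exact norm_dotT_le _ _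
    _ = 2 * ‖h‖ * ‖k‖ * ‖u‖ * ‖b - b'‖ := by ring

end ZeroForcing

/-! ### Generic beams -/

section Generic

variable {Ω : Type*} [MeasurableSpace Ω] {μ : Measure Ω} [SFinite μ] {M : ℕ}

/-- The point `(1, x, x ^ 2, …)` of the moment curve. Only finitely many points of the curve lie on
a given hyperplane, so that a random point of the curve is a generic beam. -/
def momentCurve (M : ℕ) (x : ℝ) : Vec M := WithLp.toLp 2 fun m => (x : ℂ) ^ (m : ℕ)

theorem measurable_momentCurve : Measurable (momentCurve M) := by
  have : Continuous (momentCurve M) := (PiLp.continuous_toLp 2 _).comp (by fun_prop)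
  exact this.measurable

theorem finite_setOf_dotT_momentCurve_eq_zero {g : Vec M} (hg : g ≠ 0) :
    {x : ℝ | dotT g (momentCurve M x) = 0}.Finite := by
  classical
  have hp : Polynomial.ofFn M g.ofLp ≠ 0 := fun h => hg <| by
    ext m; simpa using congrArg (Polynomial.coeff · m) h
  refine Set.Finite.of_finite_image (f := fun x : ℝ => (x : ℂ)) ?_ Complex.ofReal_injective.injOn
  refine (Polynomial.ofFn M g.ofLp).roots.toFinset.finite_toSet.subset ?_
  rintro _ ⟨x, hx, rfl⟩
  rw [Finset.mem_coe, Multiset.mem_toFinset, Polynomial.mem_roots hp]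
  simpa [Polynomial.ofFn_eq_sum_monomial, Polynomial.eval_finsetSum, dotT, momentCurve] using hx

theorem exists_forall_ae_dotT_ne_zero {ι : Type*} [Countable ι] {f : ι → Ω → Vec M}
    (hf : ∀ k, Measurable (f k)) (h0 : ∀ k, ∀ᵐ ω ∂μ, f k ω ≠ 0) :
    ∃ u : Vec M, ∀ k, ∀ᵐ ω ∂μ, dotT (f k ω) u ≠ 0 := by
  have hae : ∀ k, ∀ᵐ x : ℝ, ∀ᵐ ω ∂μ, dotT (f k ω) (momentCurve M x) ≠ 0 := fun k => by
    have hmeas : Measurable fun p : Ω × ℝ => dotT (f k p.1) (momentCurve M p.2) :=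
      measurable_dotT ((hf k).comp measurable_fst) (measurable_momentCurve.comp measurable_snd)
    rw [← Measure.ae_ae_comm (hmeas (measurableSet_singleton 0)).compl]
    filter_upwards [h0 k] with ω hω
    exact measure_mono_null (fun x hx => not_not.1 hx)
      ((finite_setOf_dotT_momentCurve_eq_zero hω).measure_zero volume)
  obtain ⟨x, hx⟩ := (ae_all_iff.2 hae).exists
  exact ⟨_, hx⟩

theorem smul_sub_smul_ne_zero {K V ι : Type*} [Ring K] [AddCommGroup V] [Module K V] {v : ι → V}
    (hv : LinearIndependent K v) {i j : ι} (hij : i ≠ j) {x : K} (hx : x ≠ 0) (y : K) :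
    x • v i - y • v j ≠ 0 := fun h => by
  have hinj : Function.Injective ![i, j] := by
    simpa [Function.Injective, Fin.forall_fin_two] using ⟨hij, hij.symm⟩
  have hpair := hv.comp ![i, j] hinj
  refine hx ?_
  simpa using Fintype.linearIndependent_iff.1 hpair ![x, -y] (by simpa [sub_eq_add_neg] using h) 0

theorem exists_generic_beams {h : Channel Ω M} (hm : ∀ t i, Measurable (h t i))
    (hli : ∀ t, ∀ᵐ ω ∂μ, LinearIndependent ℂ (fun i : Fin 2 => h t i ω)) :
    ∃ u b : Vec M, ∀ t r, (∀ᵐ ω ∂μ, dotT (h t r ω) u ≠ 0) ∧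
      (∀ᵐ ω ∂μ, beamDet (h t r ω) (h t (1 - r) ω) b u ≠ 0) ∧
      (∀ᵐ ω ∂μ, beamDet (h t r ω) (h t (1 - r) ω) (zeroForce b (h t (1 - r) ω)) u ≠ 0) := by
  have hr : ∀ r : Fin 2, r ≠ 1 - r := by decide
  obtain ⟨u, hu⟩ := exists_forall_ae_dotT_ne_zero (μ := μ) (f := fun p : ℕ × Fin 2 => h p.1 p.2)
    (fun p => hm _ _) fun p => (hli p.1).mono fun ω hω => hω.ne_zero p.2
  -- Normal vectors of the hyperplanes of those `b` for which one of the determinants vanishes.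
  let n₁ : ℕ × Fin 2 → Ω → Vec M := fun p ω =>
    dotT (h p.1 (1 - p.2) ω) u • h p.1 p.2 ω - dotT (h p.1 p.2 ω) u • h p.1 (1 - p.2) ω
  let n₂ : ℕ × Fin 2 → Ω → Vec M := fun p ω =>
    ((‖h p.1 (1 - p.2) ω‖ ^ 2 : ℝ) : ℂ) • h p.1 p.2 ω -
      dotT (h p.1 p.2 ω) (conjVec (h p.1 (1 - p.2) ω)) • h p.1 (1 - p.2) ω
  have hdot : ∀ t r, Measurable fun ω => dotT (h t r ω) u := fun t r =>
    measurable_dotT (hm t r) measurable_const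
  have hm₁ : ∀ p, Measurable (n₁ p) := fun p =>
    ((hdot _ _).smul (hm _ _)).sub ((hdot _ _).smul (hm _ _))
  have hm₂ : ∀ p, Measurable (n₂ p) := fun p =>
    ((Complex.measurable_ofReal.comp ((hm _ _).norm.pow_const 2)).smul (hm _ _)).sub
      ((measurable_dotT (hm _ _) (measurable_conjVec.comp (hm _ _))).smul (hm _ _))
  have h₁ : ∀ p, ∀ᵐ ω ∂μ, n₁ p ω ≠ 0 := fun p => by
    filter_upwards [hli p.1, hu (p.1, 1 - p.2)] with ω hω hne
    exact smul_sub_smul_ne_zero hω (hr p.2) hne _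
  have h₂ : ∀ p, ∀ᵐ ω ∂μ, n₂ p ω ≠ 0 := fun p => by
    filter_upwards [hli p.1] with ω hω
    refine smul_sub_smul_ne_zero hω (hr p.2) ?_ _
    simpa using hω.ne_zero (1 - p.2)
  obtain ⟨b, hb⟩ := exists_forall_ae_dotT_ne_zero (μ := μ) (f := Sum.elim n₁ n₂)
    (Sum.forall.2 ⟨hm₁, hm₂⟩) (Sum.forall.2 ⟨h₁, h₂⟩)
  refine ⟨u, b, fun t r => ⟨hu (t, r), ?_, ?_⟩⟩
  · simp only [beamDet_eq_dotT]
    exact hb (.inl (t, r))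
  · filter_upwards [hb (.inr (t, r)), hu (t, 1 - r)] with ω hdet hne
    rw [beamDet_zeroForce, dotT_zeroForce]
    exact mul_ne_zero hdet hne

end Generic

/-! ### Digit expansions -/

section Digits

variable {R : ℝ} {z : ℕ → ℤ}

theorem abs_sum_mul_pow_le (hR : 2 ≤ R) (hz : ∀ l, |(z l : ℝ)| ≤ R / 4) (L : ℕ) :
    |∑ l ∈ Finset.range L, (z l : ℝ) * R ^ l| ≤ R ^ L / 2 := by
  induction L with
  | zero => simp
  | succ L ih =>
    have hpow : 0 < R ^ L := by positivity
    rw [Finset.sum_range_succ, pow_succ]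
    refine (abs_add_le _ _).trans ?_
    rw [abs_mul, abs_of_pos hpow]
    nlinarith [mul_le_mul_of_nonneg_right (hz L) hpow.le]

theorem top_digit_eq_zero (hR : 2 ≤ R) (hz : ∀ l, |(z l : ℝ)| ≤ R / 4) {L : ℕ}
    (hlt : |∑ l ∈ Finset.range (L + 1), (z l : ℝ) * R ^ l| < R ^ L / 2) : z L = 0 := by
  by_contra hne
  have hpow : 0 < R ^ L := by positivity
  have hone : (1 : ℝ) ≤ |(z L : ℝ)| := by exact_mod_cast Int.one_le_abs hne
  have htop : R ^ L ≤ |(z L : ℝ) * R ^ L| := by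
    rw [abs_mul, abs_of_pos hpow]
    exact le_mul_of_one_le_left hpow.le hone
  rw [Finset.sum_range_succ, add_comm] at hlt
  have := abs_sub_abs_le_abs_add ((z L : ℝ) * R ^ L) (∑ l ∈ Finset.range L, (z l : ℝ) * R ^ l)
  linarith [abs_sum_mul_pow_le hR hz L]

theorem digits_eq_zero_of_abs_sum_lt (hR : 2 ≤ R) (hz : ∀ l, |(z l : ℝ)| ≤ R / 4) {k L : ℕ}
    (hlt : |∑ l ∈ Finset.range L, (z l : ℝ) * R ^ l| < R ^ k / 2) :
    ∀ l, k ≤ l → l < L → z l = 0 := by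
  induction L with
  | zero => simp
  | succ L ih =>
    intro l hkl hl
    have hpow : R ^ k ≤ R ^ L := pow_le_pow_right₀ (by linarith) (hkl.trans (Nat.lt_succ_iff.1 hl))
    have htop : z L = 0 := top_digit_eq_zero hR hz (by linarith)
    rcases Nat.lt_succ_iff_lt_or_eq.1 hl with h | rfl
    · rw [Finset.sum_range_succ, htop, Int.cast_zero, zero_mul, add_zero] at hlt
      exact ih hlt l hkl h
    · exact htop

end Digits

theorem exists_map_surjOn_two {X : Type*} (S T : Finset X) {K : ℕ} (hK : 0 < K)
    (hS : K ≤ S.card) (hT : K ≤ T.card) :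
    ∃ r : X → Fin K, (∀ k, ∃ p ∈ S, r p = k) ∧ ∀ k, ∃ p ∈ T, r p = k := by
  classical
  have : NeZero K := ⟨hK.ne'⟩
  obtain ⟨S', hSS, hS'⟩ := Finset.exists_subset_card_eq hS
  obtain ⟨T', hTT, hT'⟩ := Finset.exists_subset_card_eq hT
  let e : S' ≃ Fin K := S'.equivFinOfCardEq hS'
  let r₀ : X → Fin K := Function.extend Subtype.val e 0
  have hr₀ : ∀ p : S', r₀ p = e p := fun p => Subtype.val_injective.extend_apply e 0 p
  have hinj : Set.InjOn (fun p : T' => r₀ p) {p | (p : X) ∈ S'} := fun p hp p' hp' h => by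
    have h' : e ⟨p, hp⟩ = e ⟨p', hp'⟩ := by rw [← hr₀, ← hr₀]; exact h
    exact Subtype.ext (Subtype.mk.inj (e.injective h'))
  obtain ⟨g, hg⟩ := Set.MapsTo.exists_equiv_extend_of_card_eq (t := Finset.univ)
    (by simp [hT']) (fun p _ => by simp) hinj
  let r : X → Fin K := fun p => if hp : p ∈ T' then g ⟨p, hp⟩ else r₀ p
  have hrS : ∀ p : S', r p = e p := fun p => by
    rw [← hr₀]
    by_cases hp : (p : X) ∈ T'
    · simpa only [r, dif_pos hp] using hg ⟨p, hp⟩ p.2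
    · simp only [r, dif_neg hp]
  refine ⟨r, fun k => ⟨e.symm k, hSS (e.symm k).2, by rw [hrS, e.apply_symm_apply]⟩, fun k => ?_⟩
  let p : T' := g.symm ⟨k, Finset.mem_univ k⟩
  exact ⟨p, hTT p.2, by simp [r, p]⟩

/-! ### Allocation of the digits -/

theorem exists_mul_mem_Ico {s x y : ℝ} (hs : 0 ≤ s) (hxs : x < s) (hxy : x < y) (hy : 0 ≤ y) :
    ∃ c ∈ Set.Icc (0 : ℝ) 1, x < c * s ∧ c * s ≤ y := by
  rcases le_or_gt s y with hsy | hsy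
  · exact ⟨1, by simp, by simpa using hxs, by simpa using hsy⟩
  · have hs' : s ≠ 0 := (hy.trans_lt hsy).ne'
    exact ⟨y / s, ⟨by positivity, div_le_one_of_le₀ hsy.le hs⟩, by
      rwa [div_mul_cancel₀ _ hs'], (div_mul_cancel₀ _ hs').le⟩

theorem exists_add_mul_sub_eq {x y z : ℝ} (hxz : x ≤ z) (hzy : z ≤ y) :
    ∃ θ ∈ Set.Icc (0 : ℝ) 1, x + θ * (y - x) = z := by
  have hz : z ∈ (fun θ : ℝ => x + θ • (y - x)) '' Set.Icc 0 1 := by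
    rw [← segment_eq_image', segment_eq_Icc (hxz.trans hzy)]
    exact ⟨hxz, hzy⟩
  simpa using hz

theorem exists_power_exponents {Tc : ℕ} {α : ℕ → ℝ} {b d : ℝ} (h0 : ∀ j, 0 ≤ α j)
    (hb : ∀ j, α j ≤ b) (hd : 1 / 2 ≤ d) (hd1 : d < 1)
    (hα : (3 * d - 2) * Tc < ∑ j ∈ Finset.range Tc, α j) (hdb : 2 * d - 1 ≤ b) :
    ∃ α' δ : ℕ → ℝ, (∀ j, 0 ≤ α' j ∧ α' j ≤ α j ∧ α' j ≤ δ j ∧ δ j ≤ b) ∧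
      ∑ j ∈ Finset.range Tc, δ j = (2 * d - 1) * Tc ∧
      (3 * d - 2) * Tc < ∑ j ∈ Finset.range Tc, α' j := by
  have hT : (0 : ℝ) < Tc := Nat.cast_pos.2 (Nat.pos_of_ne_zero (by rintro rfl; simp at hα))
  obtain ⟨c, ⟨hc0, hc1⟩, hlt, hle⟩ := exists_mul_mem_Ico (Finset.sum_nonneg fun j _ => h0 j) hα
    (y := (2 * d - 1) * Tc) (by nlinarith) (mul_nonneg (by linarith) hT.le)
  obtain ⟨θ, ⟨hθ0, hθ1⟩, hθ⟩ := exists_add_mul_sub_eq hle (mul_le_mul_of_nonneg_right hdb hT.le)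
  have hcα : ∀ j, c * α j ≤ α j := fun j => mul_le_of_le_one_left (h0 j) hc1
  have hgap : ∀ j, 0 ≤ b - c * α j := fun j => sub_nonneg.2 ((hcα j).trans (hb j))
  refine ⟨fun j => c * α j, fun j => c * α j + θ * (b - c * α j), fun j =>
    ⟨mul_nonneg hc0 (h0 j), hcα j, le_add_of_nonneg_right (mul_nonneg hθ0 (hgap j)), ?_⟩, ?_, ?_⟩
  · linarith [mul_le_of_le_one_left (hgap j) hθ1]
  · rw [← hθ]
    simp [Finset.sum_add_distrib, ← Finset.mul_sum, mul_comm]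
  · rwa [← Finset.mul_sum]

/-- The numbers of digits, per real dimension, that the symbols of the block scheme get when blocks
have `Tc` slots and amplitudes have `N` digits. The private signal intended for user `v` has in slot
`j` of a block two symbols, with `D v j` and with `D v j - a v j` digits. A user receives the signal
intended for the other one with `D v j - a v j` digits, and 18 guard digits are spent on reporting
each of these numbers. Each block also conveys `f v` fresh digits for user `v`. All this is carried
by `K` complex common symbols of one digit per real dimension. -/
structure DigitAllocation (Tc N : ℕ) where
  K : ℕ
  D : Fin 2 → ℕ → ℕ
  a : Fin 2 → ℕ → ℕ
  f : Fin 2 → ℕ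
  K_pos : 0 < K
  a_le : ∀ v j, a v j ≤ D v j
  D_add_le : ∀ v j, D v j + 20 ≤ N
  budget : ∑ v, (∑ j ∈ Finset.range Tc, 2 * (D v j - a v j + 18) + f v) ≤ 2 * K
  room : ∀ v, K ≤ ∑ j ∈ Finset.range Tc, (N - 23 - D v j)

namespace DigitAllocation

variable {Tc N : ℕ} (A : DigitAllocation Tc N)

/-- The number of digits that user `v` gets in one block. -/
def total (v : Fin 2) : ℕ :=
  ∑ j ∈ Finset.range Tc, 2 * (A.D v j + (A.D v j - A.a v j)) + A.f v

theorem Tc_pos (A : DigitAllocation Tc N) : 0 < Tc := by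
  rcases Nat.eq_zero_or_pos Tc with rfl | hTc
  · exact absurd (A.room 0) (by simpa using A.K_pos.ne')
  · exact hTc

end DigitAllocation

/-- Exponents of the amounts of information in a `DigitAllocation`: `N` times these exponents are
numbers of digits, up to a constant. -/
structure ExponentAllocation (Tc : ℕ) where
  κ : ℝ
  δ : Fin 2 → ℕ → ℝ
  α : Fin 2 → ℕ → ℝ
  φ : Fin 2 → ℝ
  κ_pos : 0 < κ
  φ_nonneg : ∀ v, 0 ≤ φ v
  α_nonneg : ∀ v j, 0 ≤ α v j
  α_le : ∀ v j, α v j ≤ δ v j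
  δ_le : ∀ v j, δ v j ≤ 1
  budget : ∑ v, (∑ j ∈ Finset.range Tc, 2 * (δ v j - α v j) + φ v) < 2 * κ
  room : ∀ v, κ < ∑ j ∈ Finset.range Tc, (1 - δ v j)

namespace ExponentAllocation

variable {Tc : ℕ} (X : ExponentAllocation Tc)

/-- The exponent of the amount of information that user `v` gets in one block. -/
def total (v : Fin 2) : ℝ :=
  ∑ j ∈ Finset.range Tc, 2 * (X.δ v j + (X.δ v j - X.α v j)) + X.φ v

end ExponentAllocation

theorem exists_exponentAllocation {Tc : ℕ} {α : Fin 2 → ℕ → ℝ} {β : Fin 2 → ℝ} {d ε : ℝ}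
    (h0 : ∀ v j, 0 ≤ α v j) (hb : ∀ v j, α v j ≤ β v) (hβ : ∀ v, β v ≤ 1) (hd : 1 / 2 ≤ d)
    (hd1 : d < 1) (hα : ∀ v, (3 * d - 2) * Tc < ∑ j ∈ Finset.range Tc, α v j)
    (hdb : ∀ v, 2 * d - 1 ≤ β v) (hε : 0 < ε) :
    ∃ X : ExponentAllocation Tc, (∀ v j, X.δ v j ≤ β v) ∧ (∀ v j, X.α v j ≤ α v j) ∧
      ∀ v, 2 * (d - ε) * Tc < X.total v := by
  have hT : (0 : ℝ) < Tc :=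
    Nat.cast_pos.2 (Nat.pos_of_ne_zero (by rintro rfl; simpa using hα 0))
  choose α' δ hαδ hδs hαs using fun v => exists_power_exponents (h0 v) (hb v) hd hd1 (hα v) (hdb v)
  -- Without slack, the budget would hold with equality for `κ = (2 - 2 d) Tc` and this `F`.
  let F : Fin 2 → ℝ := fun v => 2 * (∑ j ∈ Finset.range Tc, α' v j - (3 * d - 2) * Tc)
  have hF : ∀ v, 0 < F v := fun v => mul_pos two_pos (sub_pos.2 (hαs v))
  have hκ : 0 < (2 - 2 * d) * Tc := mul_pos (by linarith) hT
  obtain ⟨γ, ⟨hγε, hγκ, hγF⟩, hγ⟩ : ∃ γ : ℝ, (γ < ε * Tc ∧ γ < (2 - 2 * d) * Tc ∧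
      ∀ v, γ < F v / 2) ∧ 0 < γ :=
    ((eventually_nhdsWithin_of_eventually_nhds ((eventually_lt_nhds (mul_pos hε hT)).and
      ((eventually_lt_nhds hκ).and (eventually_all.2 fun v =>
        eventually_lt_nhds (half_pos (hF v)))))).and (self_mem_nhdsWithin (s := Set.Ioi 0))).exists
  exact ⟨{ κ := (2 - 2 * d) * Tc - γ
           δ := δ
           α := α'
           φ := fun v => F v - 2 * γ
           κ_pos := sub_pos.2 hγκ
           φ_nonneg := fun v => by linarith [hγF v]
           α_nonneg := fun v j => (hαδ v j).1
           α_le := fun v j => (hαδ v j).2.2.1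
           δ_le := fun v j => (hαδ v j).2.2.2.trans (hβ v)
           budget := by
            simp only [Fin.sum_univ_two, ← Finset.mul_sum, Finset.sum_sub_distrib, hδs, F]
            linarith
           room := fun v => by
            simp only [Finset.sum_sub_distrib, hδs, Finset.sum_const, Finset.card_range,
              nsmul_eq_mul]
            linarith },
    fun v j => (hαδ v j).2.2.2, fun v j => (hαδ v j).2.1, fun v => by
      simp only [ExponentAllocation.total, ← Finset.mul_sum, Finset.sum_add_distrib,
        Finset.sum_sub_distrib, hδs, F]
      linarith⟩

/-- The number of digits, out of `N`, that carry the fraction `x` of the power exponent, less `c`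
guard digits. -/
def digitCount (c N : ℕ) (x : ℝ) : ℕ := ⌊N * x⌋₊ - c

theorem digitCount_eq_zero_or_add_le {x : ℝ} (hx : 0 ≤ x) (c N : ℕ) :
    digitCount c N x = 0 ∨ (digitCount c N x : ℝ) + c ≤ N * x := by
  rcases le_total ⌊N * x⌋₊ c with h | h
  · exact .inl (Nat.sub_eq_zero_of_le h)
  · refine .inr ?_
    rw [digitCount, Nat.cast_sub h, sub_add_cancel]
    exact Nat.floor_le (by positivity)

theorem digitCount_mono {c N : ℕ} {x y : ℝ} (hxy : x ≤ y) : digitCount c N x ≤ digitCount c N y :=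
  Nat.sub_le_sub_right (Nat.floor_le_floor (mul_le_mul_of_nonneg_left hxy N.cast_nonneg)) c

theorem digitCount_add_le {c N : ℕ} {x : ℝ} (hx : x ≤ 1) (hc : c ≤ N) :
    digitCount c N x + c ≤ N := by
  have hfloor : ⌊N * x⌋₊ ≤ N := Nat.floor_le_of_le (mul_le_of_le_one_right N.cast_nonneg hx)
  unfold digitCount
  omega

theorem tendsto_digitCount_div {x : ℝ} (hx : 0 ≤ x) (c : ℕ) :
    Tendsto (fun N : ℕ => (digitCount c N x : ℝ) / N) atTop (𝓝 x) := by
  have hfloor : Tendsto (fun N : ℕ => (⌊N * x⌋₊ : ℝ) / N) atTop (𝓝 x) := by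
    simpa only [mul_comm x, Function.comp_def] using
      (tendsto_nat_floor_mul_div_atTop hx).comp tendsto_natCast_atTop_atTop
  have hlow := hfloor.sub (tendsto_const_div_atTop_nhds_zero_nat (c : ℝ))
  rw [sub_zero] at hlow
  refine tendsto_of_tendsto_of_tendsto_of_le_of_le hlow hfloor (fun N => ?_) fun N => ?_
  · have h : (⌊N * x⌋₊ : ℝ) ≤ digitCount c N x + c := by
      exact_mod_cast le_tsub_add
    simp only
    rw [← sub_div]
    gcongr
    linarith
  · exact div_le_div_of_nonneg_right (Nat.cast_le.2 (Nat.sub_le _ _)) N.cast_nonneg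

theorem cast_digitCount_sub {c N : ℕ} {x y : ℝ} (hxy : x ≤ y) :
    ((digitCount c N y - digitCount c N x : ℕ) : ℝ) = digitCount c N y - digitCount c N x :=
  Nat.cast_sub (digitCount_mono hxy)

namespace ExponentAllocation

variable {Tc : ℕ} (X : ExponentAllocation Tc)

theorem δ_nonneg (v : Fin 2) (j : ℕ) : 0 ≤ X.δ v j := (X.α_nonneg v j).trans (X.α_le v j)

theorem eventually_budget : ∀ᶠ N : ℕ in atTop,
    ∑ v, (∑ j ∈ Finset.range Tc, 2 * (digitCount 20 N (X.δ v j) - digitCount 20 N (X.α v j) + 18) +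
      digitCount 0 N (X.φ v)) ≤ 2 * digitCount 0 N X.κ := by
  have hlim := tendsto_finsetSum Finset.univ fun v _ => (tendsto_finsetSum (Finset.range Tc)
    fun j _ => ((((tendsto_digitCount_div (X.δ_nonneg v j) 20).sub
      (tendsto_digitCount_div (X.α_nonneg v j) 20)).add
      (tendsto_const_div_atTop_nhds_zero_nat 18)).const_mul 2)).add
      (tendsto_digitCount_div (X.φ_nonneg v) 0)
  simp only [add_zero] at hlim
  filter_upwards [hlim.eventually_lt ((tendsto_digitCount_div X.κ_pos.le 0).const_mul 2) X.budget,
    eventually_gt_atTop 0] with N hlt hN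
  simp only [← sub_div, ← add_div, ← mul_div_assoc, ← Finset.sum_div] at hlt
  rw [div_lt_div_iff_of_pos_right (by exact_mod_cast hN)] at hlt
  simp only [← cast_digitCount_sub (X.α_le _ _)] at hlt
  exact_mod_cast hlt.le

theorem eventually_room : ∀ᶠ N : ℕ in atTop, ∀ v,
    digitCount 0 N X.κ ≤ ∑ j ∈ Finset.range Tc, (N - 23 - digitCount 20 N (X.δ v j)) := by
  refine eventually_all.2 fun v => ?_
  have hlim := tendsto_finsetSum (Finset.range Tc) fun j _ =>
    ((tendsto_const_div_atTop_nhds_zero_nat 23).const_sub 1).sub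
      (tendsto_digitCount_div (X.δ_nonneg v j) 20)
  simp only [sub_zero] at hlim
  filter_upwards [(tendsto_digitCount_div X.κ_pos.le 0).eventually_lt hlim (X.room v),
    eventually_gt_atTop 0] with N hlt hN
  have hN0 : (0 : ℝ) < N := by exact_mod_cast hN
  simp only [one_sub_div hN0.ne', ← sub_div, ← Finset.sum_div] at hlt
  rw [div_lt_div_iff_of_pos_right hN0] at hlt
  have hcast : (digitCount 0 N X.κ : ℝ) ≤
      ((∑ j ∈ Finset.range Tc, (N - 23 - digitCount 20 N (X.δ v j)) : ℕ) : ℝ) := by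
    rw [Nat.cast_sum]
    refine hlt.le.trans (Finset.sum_le_sum fun j _ => ?_)
    rw [sub_sub, sub_le_iff_le_add, Nat.sub_sub]
    exact_mod_cast le_tsub_add
  exact_mod_cast hcast

theorem eventually_lt_total {v : Fin 2} {c : ℝ} (hc : c < X.total v) : ∀ᶠ N : ℕ in atTop,
    c * N < ((∑ j ∈ Finset.range Tc, 2 * (digitCount 20 N (X.δ v j) +
      (digitCount 20 N (X.δ v j) - digitCount 20 N (X.α v j))) + digitCount 0 N (X.φ v) : ℕ) :
        ℝ) := by
  have hδ := fun j => tendsto_digitCount_div (X.δ_nonneg v j) 20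
  have hlim := (tendsto_finsetSum (Finset.range Tc) fun j _ => ((hδ j).add
    ((hδ j).sub (tendsto_digitCount_div (X.α_nonneg v j) 20))).const_mul 2).add
      (tendsto_digitCount_div (X.φ_nonneg v) 0)
  filter_upwards [hlim.eventually_const_lt hc, eventually_gt_atTop 0] with N hlt hN
  simp only [← sub_div, ← add_div, ← mul_div_assoc, ← Finset.sum_div] at hlt
  rw [lt_div_iff₀ (by exact_mod_cast hN)] at hlt
  simp only [← cast_digitCount_sub (X.α_le _ _)] at hlt
  exact_mod_cast hlt

theorem eventually_exists_digitAllocation {c : Fin 2 → ℝ} (hc : ∀ v, c v < X.total v) :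
    ∀ᶠ N : ℕ in atTop, ∃ A : DigitAllocation Tc N,
      (∀ v j, A.D v j = digitCount 20 N (X.δ v j)) ∧
      (∀ v j, A.a v j = digitCount 20 N (X.α v j)) ∧ ∀ v, c v * N < A.total v := by
  filter_upwards [eventually_ge_atTop 20, X.eventually_budget, X.eventually_room,
    eventually_all.2 fun v => X.eventually_lt_total (hc v),
    (tendsto_digitCount_div X.κ_pos.le 0).eventually_const_lt X.κ_pos] with N hN hbud hrm htot hK
  have hN0 : (0 : ℝ) < N := by exact_mod_cast (by omega : 0 < N)
  exact ⟨{ K := digitCount 0 N X.κ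
           D := fun v j => digitCount 20 N (X.δ v j)
           a := fun v j => digitCount 20 N (X.α v j)
           f := fun v => digitCount 0 N (X.φ v)
           K_pos := by exact_mod_cast (div_pos_iff_of_pos_right hN0).1 hK
           a_le := fun v j => digitCount_mono (X.α_le v j)
           D_add_le := fun v j => digitCount_add_le (X.δ_le v j) hN
           budget := hbud
           room := hrm }, fun _ _ => rfl, fun _ _ => rfl, htot⟩

end ExponentAllocation

theorem eventually_exists_digitAllocation {Tc : ℕ} {α : Fin 2 → ℕ → ℝ} {β : Fin 2 → ℝ} {d ε : ℝ}
    (h0 : ∀ v j, 0 ≤ α v j) (hb : ∀ v j, α v j ≤ β v) (hβ : ∀ v, β v ≤ 1) (hd : 1 / 2 ≤ d)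
    (hd1 : d < 1) (hα : ∀ v, (3 * d - 2) * Tc < ∑ j ∈ Finset.range Tc, α v j)
    (hdb : ∀ v, 2 * d - 1 ≤ β v) (hε : 0 < ε) :
    ∀ᶠ N : ℕ in atTop, ∃ A : DigitAllocation Tc N,
      (∀ v j, A.D v j = 0 ∨ (A.D v j : ℝ) + 20 ≤ N * β v) ∧
      (∀ v j, A.a v j = 0 ∨ (A.a v j : ℝ) + 20 ≤ N * α v j) ∧
      ∀ v, 2 * (d - ε) * Tc * N < A.total v := by
  obtain ⟨X, hδ, hα', htot⟩ := exists_exponentAllocation h0 hb hβ hd hd1 hα hdb hε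
  filter_upwards [X.eventually_exists_digitAllocation htot] with N ⟨A, hD, ha, hA⟩
  refine ⟨A, fun v j => ?_, fun v j => ?_, hA⟩
  · rw [hD]
    refine (digitCount_eq_zero_or_add_le (X.δ_nonneg v j) 20 N).imp_right fun h => h.trans ?_
    exact mul_le_mul_of_nonneg_left (hδ v j) N.cast_nonneg
  · rw [ha]
    refine (digitCount_eq_zero_or_add_le (X.α_nonneg v j) 20 N).imp_right fun h => h.trans ?_
    exact mul_le_mul_of_nonneg_left (hα' v j) N.cast_nonneg

/-! ### One time slot -/

section Slot

variable {M : ℕ} {R : ℝ} {h k g c b u v p : Vec M} {x y : ℂ}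

theorem mul_pow_le_one_of_le {x : ℝ} {m n : ℕ} (hx : 0 ≤ x) (hR : 1 ≤ R) (hmn : m ≤ n)
    (h : x * R ^ n ≤ 1) : x * R ^ m ≤ 1 :=
  (mul_le_mul_of_nonneg_left (pow_le_pow_right₀ hR hmn) hx).trans h

theorem norm_le_two_mul_of_norm_sub_mul_pow_le (hR : 1 ≤ R) (hk : ‖k‖ ≤ R) {m : ℕ}
    (hkc : ‖k - c‖ * R ^ m ≤ 1) : ‖c‖ ≤ 2 * R := by
  have herr : ‖k - c‖ ≤ 1 := by
    simpa using mul_pow_le_one_of_le (norm_nonneg _) hR (Nat.zero_le m) hkc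
  linarith [norm_le_norm_add_norm_sub k c]

theorem norm_zeroForce_le_pow (hR : 12 ≤ R) (hb : ‖b‖ ≤ R) (hk : ‖k‖ ≤ R) {m : ℕ}
    (hkc : ‖k - c‖ * R ^ m ≤ 1) : ‖zeroForce b c‖ ≤ R ^ 4 := by
  have hc := norm_le_two_mul_of_norm_sub_mul_pow_le (by linarith) hk hkc
  calc ‖zeroForce b c‖ ≤ 2 * ‖c‖ ^ 2 * ‖b‖ := norm_zeroForce_le b c
    _ ≤ 2 * (2 * R) ^ 2 * R := by gcongr
    _ = 8 * R ^ 3 := by ring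
    _ ≤ R * R ^ 3 := by gcongr; linarith
    _ = R ^ 4 := by ring

theorem norm_dotT_zeroForce_mul_pow_le (hR : 12 ≤ R) (hb : ‖b‖ ≤ R) (hk : ‖k‖ ≤ R) {a : ℕ}
    (hkc : ‖k - c‖ * R ^ (a + 7) ≤ 1) : ‖dotT k (zeroForce b c)‖ * R ^ a ≤ 1 := by
  have hdot : dotT k (zeroForce b c) = dotT (k - c) (zeroForce b c) := by
    rw [sub_dotT, dotT_zeroForce_self, sub_zero]
  calc ‖dotT k (zeroForce b c)‖ * R ^ a ≤ ‖k - c‖ * R ^ 4 * R ^ a := by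
        rw [hdot]
        gcongr
        exact (norm_dotT_le _ _).trans (by gcongr; exact norm_zeroForce_le_pow hR hb hk hkc)
    _ = ‖k - c‖ * R ^ (a + 4) := by ring
    _ ≤ 1 := mul_pow_le_one_of_le (norm_nonneg _) (by linarith) (by omega) hkc

theorem one_le_mul_norm_beamDet_zeroForce (hR : 12 ≤ R) (hh : ‖h‖ ≤ R) (hk : ‖k‖ ≤ R)
    (hb : ‖b‖ ≤ R) (hu : ‖u‖ ≤ R) (hkc : ‖k - c‖ * R ^ 7 ≤ 1)
    (hdet : 2 ≤ R * ‖beamDet h k (zeroForce b k) u‖) :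
    1 ≤ R * ‖beamDet h k (zeroForce b c) u‖ := by
  have hc := norm_le_two_mul_of_norm_sub_mul_pow_le (by linarith) hk hkc
  have hbeam : ‖zeroForce b k - zeroForce b c‖ ≤ 2 * R * (R + 2 * R) * ‖k - c‖ :=
    (norm_zeroForce_sub_le b k c).trans (by gcongr)
  have hsub : R * ‖beamDet h k (zeroForce b k) u - beamDet h k (zeroForce b c) u‖ ≤ 1 := by
    calc R * ‖beamDet h k (zeroForce b k) u - beamDet h k (zeroForce b c) u‖
        ≤ R * (2 * ‖h‖ * ‖k‖ * ‖u‖ * ‖zeroForce b k - zeroForce b c‖) := by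
          gcongr; exact norm_beamDet_sub_le ..
      _ ≤ R * (2 * R * R * R * (2 * R * (R + 2 * R) * ‖k - c‖)) := by gcongr
      _ = ‖k - c‖ * (12 * R ^ 6) := by ring
      _ ≤ ‖k - c‖ * (R * R ^ 6) := by gcongr
      _ = ‖k - c‖ * R ^ 7 := by ring
      _ ≤ 1 := hkc
  have hnorm := mul_le_mul_of_nonneg_left
    (norm_sub_norm_le (beamDet h k (zeroForce b k) u) (beamDet h k (zeroForce b c) u))
    (by linarith : 0 ≤ R)
  linarith

theorem norm_smul_add_smul_le_pow (hR : 12 ≤ R) {D : ℕ} (hx : ‖x‖ ≤ 2 * R ^ D)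
    (hy : ‖y‖ ≤ 2 * R ^ D) (hv : ‖v‖ ≤ R ^ 4) (hu : ‖u‖ ≤ R ^ 4) :
    ‖x • v + y • u‖ ≤ R ^ (D + 5) := by
  calc ‖x • v + y • u‖ ≤ ‖x‖ * ‖v‖ + ‖y‖ * ‖u‖ := by
        simpa only [norm_smul] using norm_add_le (x • v) (y • u)
    _ ≤ 2 * R ^ D * R ^ 4 + 2 * R ^ D * R ^ 4 := by gcongr
    _ = 4 * R ^ (D + 4) := by ring
    _ ≤ R * R ^ (D + 4) := by gcongr; linarith
    _ = R ^ (D + 5) := by ring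

theorem norm_dotT_smul_add_smul_le_pow (hR : 12 ≤ R) {a e : ℕ} (hx : ‖x‖ ≤ 2 * R ^ (e + a))
    (hy : ‖y‖ ≤ 2 * R ^ e) (hkv : ‖dotT k v‖ * R ^ a ≤ R ^ 2) (hku : ‖dotT k u‖ ≤ R ^ 2) :
    ‖dotT k (x • v + y • u)‖ ≤ R ^ (e + 3) := by
  calc ‖dotT k (x • v + y • u)‖ ≤ ‖x‖ * ‖dotT k v‖ + ‖y‖ * ‖dotT k u‖ := by
        simpa only [dotT_add, dotT_smul, norm_mul] using
          norm_add_le (x * dotT k v) (y * dotT k u)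
    _ ≤ 2 * R ^ (e + a) * ‖dotT k v‖ + 2 * R ^ e * R ^ 2 := by gcongr
    _ = 2 * R ^ e * (‖dotT k v‖ * R ^ a) + 2 * R ^ e * R ^ 2 := by ring
    _ ≤ 2 * R ^ e * R ^ 2 + 2 * R ^ e * R ^ 2 := by gcongr
    _ = 4 * R ^ (e + 2) := by ring
    _ ≤ R * R ^ (e + 2) := by gcongr; linarith
    _ = R ^ (e + 3) := by ring

theorem pow_mul_norm_dotT_sub_le_one {D : ℕ} (hp : ‖p‖ ≤ R ^ (D + 5))
    (hg : p = 0 ∨ ‖k - g‖ * R ^ (D + 17) ≤ 1) : R ^ 12 * ‖dotT (k - g) p‖ ≤ 1 := by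
  rcases hg with rfl | hg
  · simp [dotT_eq_inner]
  · calc R ^ 12 * ‖dotT (k - g) p‖ ≤ R ^ 12 * (‖k - g‖ * R ^ (D + 5)) := by
          gcongr
          exact (norm_dotT_le _ _).trans (by gcongr)
      _ = ‖k - g‖ * R ^ (D + 17) := by ring
      _ ≤ 1 := hg

theorem mul_beamDet_eq_left (h k u v : Vec M) (x y : ℂ) : x * beamDet h k v u =
    dotT k u * dotT h (x • v + y • u) - dotT h u * dotT k (x • v + y • u) := by
  simp only [beamDet, dotT_add, dotT_smul]; ring

theorem mul_beamDet_eq_right (h k u v : Vec M) (x y : ℂ) : y * beamDet h k v u =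
    dotT h v * dotT k (x • v + y • u) - dotT k v * dotT h (x • v + y • u) := by
  simp only [beamDet, dotT_add, dotT_smul]; ring

theorem norm_lt_one_of_mul_eq_sub {z Δ c₁ c₂ s₁ s₂ : ℂ} (hR : 12 ≤ R)
    (hz : z * Δ = c₁ * s₁ - c₂ * s₂) (hΔ : 1 ≤ R * ‖Δ‖) (hc₁ : ‖c₁‖ ≤ R ^ 5) (hc₂ : ‖c₂‖ ≤ R ^ 5)
    (hs₁ : R ^ 12 * ‖s₁‖ ≤ 3 * R) (hs₂ : R ^ 12 * ‖s₂‖ ≤ 3 * R) : ‖z‖ < 1 := by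
  have : 0 < R := by linarith
  have hmul : R ^ 6 * ‖z‖ ≤ 6 * R := by
    calc R ^ 6 * ‖z‖ ≤ R ^ 6 * (‖z‖ * (R * ‖Δ‖)) := by
          gcongr; exact le_mul_of_one_le_right (norm_nonneg z) hΔ
      _ = R ^ 7 * ‖c₁ * s₁ - c₂ * s₂‖ := by rw [← hz, norm_mul]; ring
      _ ≤ R ^ 7 * (‖c₁‖ * ‖s₁‖ + ‖c₂‖ * ‖s₂‖) := by
          gcongr; simpa only [norm_mul] using norm_sub_le (c₁ * s₁) (c₂ * s₂)
      _ ≤ R ^ 7 * (R ^ 5 * ‖s₁‖ + R ^ 5 * ‖s₂‖) := by gcongr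
      _ = R ^ 12 * ‖s₁‖ + R ^ 12 * ‖s₂‖ := by ring
      _ ≤ 6 * R := by linarith
  refine lt_of_mul_lt_mul_left (hmul.trans_lt ?_) (by positivity : 0 ≤ R ^ 6)
  calc 6 * R < R * R := by gcongr; linarith
    _ = R ^ 2 := (sq R).symm
    _ ≤ R ^ 6 := pow_le_pow_right₀ (by linarith) (by norm_num)
    _ = R ^ 6 * 1 := (mul_one _).symm

theorem norm_lt_one_of_norm_dotT_smul_add_smul_le (hR : 12 ≤ R) (hh : ‖h‖ ≤ R) (hk : ‖k‖ ≤ R)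
    (hu : ‖u‖ ≤ R ^ 4) (hv : ‖v‖ ≤ R ^ 4) (hdet : 1 ≤ R * ‖beamDet h k v u‖)
    (h₁ : R ^ 12 * ‖dotT h (x • v + y • u)‖ ≤ 3 * R)
    (h₂ : R ^ 12 * ‖dotT k (x • v + y • u)‖ ≤ 3 * R) : ‖x‖ < 1 ∧ ‖y‖ < 1 := by
  have hdot : ∀ {f w : Vec M}, ‖f‖ ≤ R → ‖w‖ ≤ R ^ 4 → ‖dotT f w‖ ≤ R ^ 5 := fun {f w} hf hw =>
    calc ‖dotT f w‖ ≤ ‖f‖ * ‖w‖ := norm_dotT_le f w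
      _ ≤ R * R ^ 4 := by gcongr
      _ = R ^ 5 := by ring
  exact ⟨norm_lt_one_of_mul_eq_sub hR (mul_beamDet_eq_left h k u v x y) hdet
      (hdot hk hu) (hdot hh hu) h₁ h₂,
    norm_lt_one_of_mul_eq_sub hR (mul_beamDet_eq_right h k u v x y) hdet
      (hdot hh hv) (hdot hk hv) h₂ h₁⟩

end Slot

/-! ### Quantisation -/

section Quantise

/-- The two-dimensional quantiser with step `R ^ (-12)`, modulo `m`. It conveys a complex number to
someone who already knows it with error less than about `m * R ^ (-12)`. -/
def quantise (R : ℝ) (m : ℕ) (x : ℂ) : ZMod m × ZMod m :=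
  (((⌊R ^ 12 * x.re⌋ : ℤ) : ZMod m), ((⌊R ^ 12 * x.im⌋ : ℤ) : ZMod m))

theorem measurable_quantise (R : ℝ) (m : ℕ) [MeasurableSpace (ZMod m)] :
    Measurable (quantise R m) := by
  have hfloor : ∀ f : ℂ → ℝ, Measurable f →
      Measurable fun x => ((⌊R ^ 12 * f x⌋ : ℤ) : ZMod m) := fun f hf =>
    (measurable_of_countable (fun z : ℤ => (z : ZMod m))).comp (hf.const_mul _).floor
  exact (hfloor _ Complex.measurable_re).prodMk (hfloor _ Complex.measurable_im)

theorem abs_sub_lt_one_of_floor_zmod_eq {m : ℕ} {x y : ℝ}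
    (hxy : ((⌊x⌋ : ℤ) : ZMod m) = ((⌊y⌋ : ℤ) : ZMod m)) (hlt : |x - y| + 1 ≤ m) :
    |x - y| < 1 := by
  have hdvd : (m : ℤ) ∣ ⌊x⌋ - ⌊y⌋ := (ZMod.intCast_eq_intCast_iff_dvd_sub _ _ _).1 hxy.symm
  have habs : |((⌊x⌋ - ⌊y⌋ : ℤ) : ℝ)| < m := by
    push_cast
    rw [abs_lt]
    constructor <;>
      linarith [Int.floor_le x, Int.lt_floor_add_one x, Int.floor_le y, Int.lt_floor_add_one y,
        le_abs_self (x - y), neg_abs_le (x - y)]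
  have hzero : ⌊x⌋ - ⌊y⌋ = 0 := Int.eq_zero_of_abs_lt_dvd hdvd (by exact_mod_cast habs)
  exact Int.abs_sub_lt_one_of_floor_eq_floor (sub_eq_zero.1 hzero)

variable {R : ℝ} {m e : ℕ}

theorem pow_mul_abs_sub_lt_one_of_floor_zmod_eq (hR : 2 ≤ R) (hm : R ^ (e + 13) ≤ m) {s t : ℝ}
    (hst : |s - t| ≤ R ^ e)
    (heq : ((⌊R ^ 12 * s⌋ : ℤ) : ZMod m) = ((⌊R ^ 12 * t⌋ : ℤ) : ZMod m)) :
    R ^ 12 * |s - t| < 1 := by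
  have hscale : R ^ 12 * |s - t| = |R ^ 12 * s - R ^ 12 * t| := by
    rw [← mul_sub, abs_mul, abs_of_nonneg (by positivity : 0 ≤ R ^ 12)]
  rw [hscale]
  refine abs_sub_lt_one_of_floor_zmod_eq heq ?_
  calc |R ^ 12 * s - R ^ 12 * t| + 1 ≤ R ^ 12 * R ^ e + R ^ (e + 12) := by
        rw [← hscale]; gcongr; exact one_le_pow₀ (by linarith)
    _ = 2 * R ^ (e + 12) := by ring
    _ ≤ R * R ^ (e + 12) := by gcongr
    _ = R ^ (e + 13) := by ring
    _ ≤ m := hm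

theorem pow_mul_norm_sub_le_two_of_quantise_eq (hR : 2 ≤ R) (hm : R ^ (e + 13) ≤ m) {x y : ℂ}
    (hxy : quantise R m x = quantise R m y) (hle : ‖x - y‖ ≤ R ^ e) : R ^ 12 * ‖x - y‖ ≤ 2 := by
  have hre := pow_mul_abs_sub_lt_one_of_floor_zmod_eq hR hm
    ((Complex.abs_re_le_norm (x - y)).trans hle) (congrArg Prod.fst hxy)
  have him := pow_mul_abs_sub_lt_one_of_floor_zmod_eq hR hm
    ((Complex.abs_im_le_norm (x - y)).trans hle) (congrArg Prod.snd hxy)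
  calc R ^ 12 * ‖x - y‖ ≤ R ^ 12 * (|x.re - y.re| + |x.im - y.im|) := by
        gcongr; exact Complex.norm_le_abs_re_add_abs_im (x - y)
    _ ≤ 2 := by linarith

end Quantise

/-! ### Complex symbols -/

section Symbols

/-- The Gaussian integer whose real and imaginary parts are the given digits. -/
def symbol {m : ℕ} (x : Fin m × Fin m) : ℂ := ((x.1 : ℕ) : ℂ) + ((x.2 : ℕ) : ℂ) * Complex.I

variable {m : ℕ} (x y : Fin m × Fin m)

theorem symbol_re : (symbol x).re = (x.1 : ℕ) := by simp [symbol]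

theorem symbol_im : (symbol x).im = (x.2 : ℕ) := by simp [symbol]

theorem norm_symbol_le : ‖symbol x‖ ≤ 2 * m := by
  have h₁ : ((x.1 : ℕ) : ℝ) ≤ m := by exact_mod_cast x.1.2.le
  have h₂ : ((x.2 : ℕ) : ℝ) ≤ m := by exact_mod_cast x.2.2.le
  calc ‖symbol x‖ ≤ |(symbol x).re| + |(symbol x).im| := Complex.norm_le_abs_re_add_abs_im _
    _ = (x.1 : ℕ) + (x.2 : ℕ) := by rw [symbol_re, symbol_im, Nat.abs_cast, Nat.abs_cast]
    _ ≤ 2 * m := by linarith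

theorem norm_symbol_sub_le : ‖symbol x - symbol y‖ ≤ 2 * m := by
  have hdigit : ∀ a b : Fin m, |((a : ℕ) : ℝ) - (b : ℕ)| ≤ m := fun a b =>
    abs_sub_le_of_nonneg_of_le (Nat.cast_nonneg _) (by exact_mod_cast a.2.le)
      (Nat.cast_nonneg _) (by exact_mod_cast b.2.le)
  refine (Complex.norm_le_abs_re_add_abs_im _).trans ?_
  rw [Complex.sub_re, Complex.sub_im, symbol_re, symbol_im, symbol_re, symbol_im]
  linarith [hdigit x.1 y.1, hdigit x.2 y.2]

variable {x y}

theorem eq_of_norm_symbol_sub_lt_one (h : ‖symbol x - symbol y‖ < 1) : x = y := by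
  have hdigit : ∀ a b : Fin m, |((a : ℕ) : ℝ) - (b : ℕ)| < 1 → a = b := fun a b hab => by
    have hint : |((a : ℕ) : ℤ) - ((b : ℕ) : ℤ)| < 1 := by exact_mod_cast hab
    exact Fin.ext (by have := Int.abs_lt_one_iff.1 hint; omega)
  have hre := (Complex.abs_re_le_norm _).trans_lt h
  have him := (Complex.abs_im_le_norm _).trans_lt h
  rw [Complex.sub_re, symbol_re, symbol_re] at hre
  rw [Complex.sub_im, symbol_im, symbol_im] at him
  exact Prod.ext (hdigit _ _ hre) (hdigit _ _ him)

/-- The superposition of the symbols `x l` on the amplitude levels `l < L`. -/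
def superpose {q : ℕ} (R : ℝ) (L : ℕ) (x : ℕ → Fin q × Fin q) : ℂ :=
  ∑ l ∈ Finset.range L, symbol (x l) * ((R ^ l : ℝ) : ℂ)

variable {q : ℕ} {R : ℝ} {L k : ℕ} {x y : ℕ → Fin q × Fin q}

theorem superpose_re (R : ℝ) (L : ℕ) (x : ℕ → Fin q × Fin q) :
    (superpose R L x).re = ∑ l ∈ Finset.range L, ((x l).1 : ℕ) * R ^ l := by
  simp only [superpose, Complex.re_sum, Complex.re_mul_ofReal, symbol_re]

theorem superpose_im (R : ℝ) (L : ℕ) (x : ℕ → Fin q × Fin q) :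
    (superpose R L x).im = ∑ l ∈ Finset.range L, ((x l).2 : ℕ) * R ^ l := by
  simp only [superpose, Complex.im_sum, Complex.im_mul_ofReal, symbol_im]

theorem norm_superpose_le (hR : 2 ≤ R) (hq : 4 * (q : ℝ) ≤ R) (L : ℕ) (x : ℕ → Fin q × Fin q) :
    ‖superpose R L x‖ ≤ R ^ L := by
  have hdigits : ∀ d : ℕ → Fin q, |∑ l ∈ Finset.range L, ((d l : ℕ) : ℝ) * R ^ l| ≤ R ^ L / 2 :=
    fun d => by
      simpa using abs_sum_mul_pow_le (z := fun l => ((d l : ℕ) : ℤ)) hR (fun l => by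
        have : ((d l : ℕ) : ℝ) ≤ q := by exact_mod_cast (d l).2.le
        simp only [Int.cast_natCast, Nat.abs_cast]
        linarith) L
  refine (Complex.norm_le_abs_re_add_abs_im _).trans ?_
  rw [superpose_re, superpose_im]
  linarith [hdigits fun l => (x l).1, hdigits fun l => (x l).2]

theorem eq_of_abs_sum_digits_sub_lt (hR : 2 ≤ R) (hq : 4 * (q : ℝ) ≤ R) {d d' : ℕ → Fin q}
    (hlt : |∑ l ∈ Finset.range L, ((d l : ℕ) : ℝ) * R ^ l -
      ∑ l ∈ Finset.range L, ((d' l : ℕ) : ℝ) * R ^ l| < R ^ k / 2) {l : ℕ} (hk : k ≤ l)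
    (hl : l < L) : d l = d' l := by
  have hsmall : ∀ l, |(((d l : ℕ) - (d' l : ℕ) : ℤ) : ℝ)| ≤ R / 4 := fun l => by
    push_cast
    exact (abs_sub_le_of_nonneg_of_le (Nat.cast_nonneg _) (by exact_mod_cast (d l).2.le)
      (Nat.cast_nonneg _) (by exact_mod_cast (d' l).2.le)).trans (by linarith : (q : ℝ) ≤ R / 4)
  have hzero := digits_eq_zero_of_abs_sum_lt hR hsmall
    (by simpa [sub_mul, Finset.sum_sub_distrib] using hlt) l hk hl
  exact Fin.ext (by omega)

theorem eq_of_norm_superpose_sub_lt (hR : 2 ≤ R) (hq : 4 * (q : ℝ) ≤ R)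
    (hlt : ‖superpose R L x - superpose R L y‖ < R ^ k / 2) {l : ℕ} (hk : k ≤ l) (hl : l < L) :
    x l = y l := by
  have hre := (Complex.abs_re_le_norm _).trans_lt hlt
  have him := (Complex.abs_im_le_norm _).trans_lt hlt
  rw [Complex.sub_re, superpose_re, superpose_re] at hre
  rw [Complex.sub_im, superpose_im, superpose_im] at him
  exact Prod.ext (eq_of_abs_sum_digits_sub_lt hR hq hre hk hl)
    (eq_of_abs_sum_digits_sub_lt hR hq him hk hl)

end Symbols

/-! ### The block scheme -/

/-- The common information about one block: for either private signal and for every slot, the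
quantised disturbance that it causes, and the fresh digits of both users. -/
abbrev DigitAllocation.Payload {Tc N : ℕ} (A : DigitAllocation Tc N) (q : ℕ) : Type :=
  ((v : Fin 2) → (j : Fin Tc) → ZMod (q ^ (A.D v j - A.a v j + 18)) ×
    ZMod (q ^ (A.D v j - A.a v j + 18))) × ((v : Fin 2) → Fin (q ^ A.f v))

/-- The part of the block scheme that does not depend on the power. The vectors `u` and `b` are
generic beams. The estimate from which the transmitter computes the disturbance in slot `t` is that
of the channel of slot `source t` available at time `arrival t`; both are at most `t + delay`.
Common symbols are repeated: level `l` of slot `j` of a block carries the symbol number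
`rep (j, l)`. -/
structure Scheme (M Tc N : ℕ) extends DigitAllocation Tc N where
  u : Vec M
  b : Vec M
  source : ℕ → ℕ
  arrival : ℕ → ℕ
  delay : ℕ
  source_le : ∀ t, source t ≤ t + delay
  arrival_le : ∀ t, arrival t ≤ t + delay
  rep : Fin Tc × ℕ → Fin K
  /-- Either user finds every common symbol on a level above its private signal. -/
  rep_surj : ∀ v k, ∃ (j : Fin Tc) (l : ℕ), D v j + 21 ≤ l ∧ l < N - 2 ∧ rep (j, l) = k

namespace Scheme

variable {M Tc N : ℕ}

/-- A slot, number `j` of its block and `t` of all, in which the channels `H` are neither too strong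
nor ill-conditioned, and the estimates `E` are as good as their exponents promise. -/
structure GoodSlot (Z : Scheme M Tc N) (R : ℝ) (H : Fin 2 → Vec M) (E : ℕ → ℕ → Fin 2 → Vec M)
    (t : ℕ) (j : Fin Tc) : Prop where
  norm_le : ∀ v, ‖H v‖ ≤ R
  current : ∀ v, Z.a v j = 0 ∨ ‖H (1 - v) - E t t (1 - v)‖ * R ^ (Z.a v j + 7) ≤ 1
  delayed : ∀ v, Z.D v j = 0 ∨
    ‖H (1 - v) - E (Z.source t) (Z.arrival t) (1 - v)‖ * R ^ (Z.D v j + 17) ≤ 1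
  gain : ∀ v, 1 ≤ R * ‖dotT (H v) Z.u‖
  det : ∀ v, 1 ≤ R * ‖beamDet (H v) (H (1 - v)) Z.b Z.u‖
  det_zeroForce : ∀ v, 2 ≤ R * ‖beamDet (H v) (H (1 - v)) (zeroForce Z.b (H (1 - v))) Z.u‖

end Scheme

/-- The block scheme at one power. Digits are taken from `q` values and are read in the radix `R`,
so that digits that are added up cannot overlap. The payload of a block is encoded by `emb` into the
common symbols. -/
structure Layout (M Tc N : ℕ) extends Scheme M Tc N where
  q : ℕ
  R : ℝ
  emb : toDigitAllocation.Payload q ↪ (Fin K → Fin q × Fin q)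
  le_R : 12 ≤ R
  four_mul_q_le : 4 * (q : ℝ) ≤ R
  pow_R_le : ∀ k ≤ N, R ^ (k + 17) ≤ (q : ℝ) ^ (k + 18)
  norm_u_le : ‖u‖ ≤ R
  norm_b_le : ‖b‖ ≤ R

namespace Layout

variable {M Tc N : ℕ} (S : Layout M Tc N)

/-- The message that user `v` gets in one block: the digits of the two private symbols of every
slot, and the fresh digits among the common symbols. -/
abbrev Block (v : Fin 2) : Type :=
  ((j : Fin Tc) → (Fin (S.q ^ S.D v j) × Fin (S.q ^ S.D v j)) ×
    (Fin (S.q ^ (S.D v j - S.a v j)) × Fin (S.q ^ (S.D v j - S.a v j)))) × Fin (S.q ^ S.f v)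

/-- The beam of the first private symbol of user `v`: it is zero-forced at the other user, unless
the current estimate is of no use for this. -/
def beam (v : Fin 2) (t : ℕ) (j : Fin Tc) (E : ℕ → ℕ → Fin 2 → Vec M) : Vec M :=
  if S.a v j = 0 then S.b else zeroForce S.b (E t t (1 - v))

/-- The private signal of user `v` in slot `t`, number `j` of its block, for the message `m`. -/
def privateSignal (v : Fin 2) (t : ℕ) (j : Fin Tc) (m : S.Block v) (E : ℕ → ℕ → Fin 2 → Vec M) :
    Vec M :=
  symbol (m.1 j).1 • S.beam v t j E + symbol (m.1 j).2 • S.u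

/-- The report about the disturbance which the private signal of `v` causes at the other user. -/
def report (v : Fin 2) (t : ℕ) (j : Fin Tc) (m : S.Block v) (E : ℕ → ℕ → Fin 2 → Vec M) :
    ZMod (S.q ^ (S.D v j - S.a v j + 18)) × ZMod (S.q ^ (S.D v j - S.a v j + 18)) :=
  quantise S.R _ (dotT (E (S.source t) (S.arrival t) (1 - v)) (S.privateSignal v t j m E))

/-- The common information about block `s`, for the messages `w`. -/
def payload (w : ∀ v, ℕ → S.Block v) (s : ℕ) (E : ℕ → ℕ → Fin 2 → Vec M) : S.Payload S.q :=
  (fun v j => S.report v (s * Tc + j) j (w v s) E, fun v => (w v s).2)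

/-- The common signal in slot `j` of block `s`. It conveys the payload of block `s - lag`. -/
def commonSignal (lag : ℕ) (w : ∀ v, ℕ → S.Block v) (s : ℕ) (j : Fin Tc)
    (E : ℕ → ℕ → Fin 2 → Vec M) : ℂ :=
  if lag ≤ s then superpose S.R (N - 2) fun l => S.emb (S.payload w (s - lag) E) (S.rep (j, l))
  else 0

/-- The transmitted signal in slot `j` of block `s`. -/
def signal (lag : ℕ) (w : ∀ v, ℕ → S.Block v) (s : ℕ) (j : Fin Tc)
    (E : ℕ → ℕ → Fin 2 → Vec M) : Vec M :=
  S.commonSignal lag w s j E • S.u +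
    ((S.R ^ 12 : ℝ) : ℂ) • ∑ v, S.privateSignal v (s * Tc + j) j (w v s) E

theorem R_pos : 0 < S.R := by linarith [S.le_R]

theorem one_le_R : 1 ≤ S.R := by linarith [S.le_R]

theorem le_R_pow {x : ℝ} (hx : x ≤ S.R) {n : ℕ} (hn : n ≠ 0) : x ≤ S.R ^ n :=
  hx.trans (le_self_pow₀ S.one_le_R hn)

theorem pow_q_le (k : ℕ) : ((S.q ^ k : ℕ) : ℝ) ≤ S.R ^ k := by
  rw [Nat.cast_pow]
  exact pow_le_pow_left₀ (Nat.cast_nonneg _)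
    (by linarith [S.four_mul_q_le, (Nat.cast_nonneg S.q : (0 : ℝ) ≤ S.q)]) k

theorem norm_ofReal_pow_mul (n : ℕ) (z : ℂ) : ‖((S.R ^ n : ℝ) : ℂ) * z‖ = S.R ^ n * ‖z‖ := by
  rw [norm_mul, Complex.norm_real, Real.norm_of_nonneg (pow_nonneg S.R_pos.le n)]

theorem q_pos : 0 < S.q := by
  have hpow := S.pow_R_le 0 (Nat.zero_le _)
  refine Nat.pos_of_ne_zero fun hq => (pow_pos S.R_pos 17).not_ge ?_
  simpa [hq] using hpow

instance (v : Fin 2) : Nonempty (S.Block v) := by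
  have : NeZero S.q := ⟨S.q_pos.ne'⟩
  infer_instance

variable {S}

section Slot

variable {H : Fin 2 → Vec M} {E : ℕ → ℕ → Fin 2 → Vec M} {t : ℕ} {j : Fin Tc}
  (hG : S.GoodSlot S.R H E t j) (v : Fin 2)

include hG

theorem norm_beam_le : ‖S.beam v t j E‖ ≤ S.R ^ 4 := by
  unfold beam
  split_ifs with ha
  · exact S.le_R_pow S.norm_b_le four_ne_zero
  · exact norm_zeroForce_le_pow S.le_R S.norm_b_le (hG.norm_le _)
      ((hG.current v).resolve_left ha)

theorem norm_dotT_u_le : ‖dotT (H v) S.u‖ ≤ S.R ^ 2 := by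
  rw [sq]
  exact (norm_dotT_le _ _).trans
    (mul_le_mul (hG.norm_le v) S.norm_u_le (norm_nonneg _) S.R_pos.le)

theorem norm_dotT_beam_mul_pow_le :
    ‖dotT (H (1 - v)) (S.beam v t j E)‖ * S.R ^ S.a v j ≤ S.R ^ 2 := by
  unfold beam
  split_ifs with ha
  · rw [ha, pow_zero, mul_one, sq]
    exact (norm_dotT_le _ _).trans
      (mul_le_mul (hG.norm_le _) S.norm_b_le (norm_nonneg _) S.R_pos.le)
  · exact (norm_dotT_zeroForce_mul_pow_le S.le_R S.norm_b_le (hG.norm_le _)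
      ((hG.current v).resolve_left ha)).trans (one_le_pow₀ S.one_le_R)

theorem one_le_mul_norm_beamDet_beam :
    1 ≤ S.R * ‖beamDet (H v) (H (1 - v)) (S.beam v t j E) S.u‖ := by
  unfold beam
  split_ifs with ha
  · exact hG.det v
  · exact one_le_mul_norm_beamDet_zeroForce S.le_R (hG.norm_le _) (hG.norm_le _) S.norm_b_le
      S.norm_u_le (mul_pow_le_one_of_le (norm_nonneg _) S.one_le_R (by omega)
        ((hG.current v).resolve_left ha)) (hG.det_zeroForce v)

omit hG in
theorem privateSignal_sub (m m' : S.Block v) :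
    S.privateSignal v t j m E - S.privateSignal v t j m' E =
      (symbol (m.1 j).1 - symbol (m'.1 j).1) • S.beam v t j E +
        (symbol (m.1 j).2 - symbol (m'.1 j).2) • S.u := by
  simp only [privateSignal, sub_smul]; abel

omit hG in
theorem privateSignal_eq_of_D_eq_zero {v : Fin 2} (hD : S.D v j = 0) (m m' : S.Block v) :
    S.privateSignal v t j m E = S.privateSignal v t j m' E := by
  have hsub : ∀ k : ℕ, k = 0 → Subsingleton (Fin (S.q ^ k) × Fin (S.q ^ k)) := by
    rintro k rfl
    rw [pow_zero]
    infer_instance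
  have := hsub _ hD
  have := hsub _ (by omega : S.D v j - S.a v j = 0)
  rw [privateSignal, privateSignal, Subsingleton.elim (m.1 j) (m'.1 j)]

omit hG in
theorem two_mul_pow_q_le {k l : ℕ} (hkl : k ≤ l) : 2 * ((S.q ^ k : ℕ) : ℝ) ≤ 2 * S.R ^ l :=
  mul_le_mul_of_nonneg_left ((S.pow_q_le k).trans (pow_le_pow_right₀ S.one_le_R hkl)) zero_le_two

theorem norm_privateSignal_le (m : S.Block v) :
    ‖S.privateSignal v t j m E‖ ≤ S.R ^ (S.D v j + 5) :=
  norm_smul_add_smul_le_pow S.le_R ((norm_symbol_le _).trans (two_mul_pow_q_le le_rfl))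
    ((norm_symbol_le _).trans (two_mul_pow_q_le (Nat.sub_le _ _)))
    (norm_beam_le hG v) (S.le_R_pow S.norm_u_le four_ne_zero)

theorem norm_privateSignal_sub_le (m m' : S.Block v) :
    ‖S.privateSignal v t j m E - S.privateSignal v t j m' E‖ ≤ S.R ^ (S.D v j + 5) := by
  rw [privateSignal_sub]
  exact norm_smul_add_smul_le_pow S.le_R
    ((norm_symbol_sub_le _ _).trans (two_mul_pow_q_le le_rfl))
    ((norm_symbol_sub_le _ _).trans (two_mul_pow_q_le (Nat.sub_le _ _)))
    (norm_beam_le hG v) (S.le_R_pow S.norm_u_le four_ne_zero)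

theorem norm_dotT_privateSignal_sub_le (m m' : S.Block v) :
    ‖dotT (H (1 - v)) (S.privateSignal v t j m E - S.privateSignal v t j m' E)‖ ≤
      S.R ^ (S.D v j - S.a v j + 3) := by
  rw [privateSignal_sub]
  exact norm_dotT_smul_add_smul_le_pow S.le_R
    ((norm_symbol_sub_le _ _).trans
      (two_mul_pow_q_le (Nat.sub_add_cancel (S.a_le v j)).ge))
    ((norm_symbol_sub_le _ _).trans (two_mul_pow_q_le le_rfl))
    (norm_dotT_beam_mul_pow_le hG v) (norm_dotT_u_le hG _)

theorem pow_mul_norm_dotT_delayed_error_le (m m' : S.Block v) :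
    S.R ^ 12 * ‖dotT (H (1 - v) - E (S.source t) (S.arrival t) (1 - v))
      (S.privateSignal v t j m E - S.privateSignal v t j m' E)‖ ≤ 1 := by
  refine pow_mul_norm_dotT_sub_le_one (norm_privateSignal_sub_le hG v m m') ?_
  refine (hG.delayed v).imp_left fun hD => ?_
  rw [privateSignal_eq_of_D_eq_zero hD m m', sub_self]

theorem norm_dotT_delayed_privateSignal_sub_le (m m' : S.Block v) :
    ‖dotT (E (S.source t) (S.arrival t) (1 - v))
      (S.privateSignal v t j m E - S.privateSignal v t j m' E)‖ ≤
        S.R ^ (S.D v j - S.a v j + 4) := by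
  set g := E (S.source t) (S.arrival t) (1 - v)
  set p := S.privateSignal v t j m E - S.privateSignal v t j m' E
  have herr : ‖dotT (H (1 - v) - g) p‖ ≤ S.R ^ (S.D v j - S.a v j + 3) :=
    ((le_mul_of_one_le_left (norm_nonneg _) (one_le_pow₀ S.one_le_R)).trans
      (pow_mul_norm_dotT_delayed_error_le hG v m m')).trans (one_le_pow₀ S.one_le_R)
  calc ‖dotT g p‖ = ‖dotT (H (1 - v)) p - dotT (H (1 - v) - g) p‖ := by
        rw [sub_dotT, sub_sub_cancel]
    _ ≤ S.R ^ (S.D v j - S.a v j + 3) + S.R ^ (S.D v j - S.a v j + 3) :=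
        (norm_sub_le _ _).trans (add_le_add (norm_dotT_privateSignal_sub_le hG v m m') herr)
    _ = 2 * S.R ^ (S.D v j - S.a v j + 3) := by ring
    _ ≤ S.R * S.R ^ (S.D v j - S.a v j + 3) :=
        mul_le_mul_of_nonneg_right (by linarith [S.le_R]) (pow_nonneg S.R_pos.le _)
    _ = S.R ^ (S.D v j - S.a v j + 4) := by ring

theorem pow_mul_norm_disturbance_sub_le {m m' : S.Block v}
    (hreport : S.report v t j m E = S.report v t j m' E) :
    S.R ^ 12 * ‖dotT (H (1 - v)) (S.privateSignal v t j m E - S.privateSignal v t j m' E)‖ ≤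
      3 := by
  set g := E (S.source t) (S.arrival t) (1 - v)
  set p := S.privateSignal v t j m E - S.privateSignal v t j m' E with hp
  have hmod : S.R ^ (S.D v j - S.a v j + 4 + 13) ≤
      ((S.q ^ (S.D v j - S.a v j + 18) : ℕ) : ℝ) := by
    rw [Nat.cast_pow]
    exact S.pow_R_le _ (by have := S.D_add_le v j; omega)
  have hquant : S.R ^ 12 * ‖dotT g p‖ ≤ 2 := by
    have hle := norm_dotT_delayed_privateSignal_sub_le hG v m m'
    rw [dotT_sub] at hle
    rw [hp, dotT_sub]
    exact pow_mul_norm_sub_le_two_of_quantise_eq (by linarith [S.le_R]) hmod hreport hle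
  calc S.R ^ 12 * ‖dotT (H (1 - v)) p‖
      = S.R ^ 12 * ‖dotT g p + dotT (H (1 - v) - g) p‖ := by
        rw [sub_dotT, add_sub_cancel]
    _ ≤ S.R ^ 12 * ‖dotT g p‖ + S.R ^ 12 * ‖dotT (H (1 - v) - g) p‖ := by
        rw [← mul_add]
        exact mul_le_mul_of_nonneg_left (norm_add_le _ _) (pow_nonneg S.R_pos.le _)
    _ ≤ 3 := by linarith [pow_mul_norm_dotT_delayed_error_le hG v m m']

theorem symbols_eq_of_norm_dotT_privateSignal_sub_le {m m' : S.Block v}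
    (hown : S.R ^ 12 *
      ‖dotT (H v) (S.privateSignal v t j m E - S.privateSignal v t j m' E)‖ ≤ 3 * S.R)
    (hother : S.R ^ 12 *
      ‖dotT (H (1 - v)) (S.privateSignal v t j m E - S.privateSignal v t j m' E)‖ ≤ 3 * S.R) :
    m.1 j = m'.1 j := by
  rw [privateSignal_sub] at hown hother
  obtain ⟨hx, hy⟩ := norm_lt_one_of_norm_dotT_smul_add_smul_le S.le_R (hG.norm_le v)
    (hG.norm_le (1 - v)) (S.le_R_pow S.norm_u_le four_ne_zero) (norm_beam_le hG v)
    (one_le_mul_norm_beamDet_beam hG v) hown hother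
  exact Prod.ext (eq_of_norm_symbol_sub_lt_one hx) (eq_of_norm_symbol_sub_lt_one hy)

end Slot

section Blocks

variable {lag s : ℕ} {j : Fin Tc} {E : ℕ → ℕ → Fin 2 → Vec M} {w w' : ∀ v, ℕ → S.Block v}

theorem dotT_signal_sub (k : Vec M) (i : Fin 2) :
    dotT k (S.signal lag w s j E) - dotT k (S.signal lag w' s j E) =
      (S.commonSignal lag w s j E - S.commonSignal lag w' s j E) * dotT k S.u +
      ((S.R ^ 12 : ℝ) : ℂ) * dotT k (S.privateSignal i (s * Tc + j) j (w i s) E -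
        S.privateSignal i (s * Tc + j) j (w' i s) E) +
      ((S.R ^ 12 : ℝ) : ℂ) * dotT k
        (S.privateSignal (1 - i) (s * Tc + j) j (w (1 - i) s) E -
          S.privateSignal (1 - i) (s * Tc + j) j (w' (1 - i) s) E) := by
  have hsum : ∀ p : Fin 2 → Vec M, ∑ v, p v = p i + p (1 - i) := fun p => by
    rw [Fin.sum_univ_two]
    fin_cases i
    · rfl
    · exact add_comm _ _
  simp only [signal, hsum, dotT_add, dotT_smul, dotT_sub]
  ring

section

variable {H : Fin 2 → Vec M} (hG : S.GoodSlot S.R H E (s * Tc + j) j) (i : Fin 2)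

include hG

/-- Once the disturbance by the other user is known, only the common signal and the own private
signal are left above the noise. -/
theorem norm_residual_le (hpay : S.payload w s E = S.payload w' s E)
    (hclose : ‖dotT (H i) (S.signal lag w s j E) - dotT (H i) (S.signal lag w' s j E)‖ ≤
      2 * S.R) :
    ‖(S.commonSignal lag w s j E - S.commonSignal lag w' s j E) * dotT (H i) S.u +
      ((S.R ^ 12 : ℝ) : ℂ) * dotT (H i) (S.privateSignal i (s * Tc + j) j (w i s) E -
        S.privateSignal i (s * Tc + j) j (w' i s) E)‖ ≤ 3 * S.R := by
  have hdist := pow_mul_norm_disturbance_sub_le hG (1 - i)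
    (congrFun (congrFun (congrArg Prod.fst hpay) (1 - i)) j)
  rw [sub_sub_cancel, ← S.norm_ofReal_pow_mul] at hdist
  rw [eq_sub_of_add_eq (dotT_signal_sub (H i) i).symm]
  refine (norm_sub_le _ _).trans ?_
  linarith [S.le_R]

theorem norm_commonSignal_sub_lt (hpay : S.payload w s E = S.payload w' s E)
    (hclose : ‖dotT (H i) (S.signal lag w s j E) - dotT (H i) (S.signal lag w' s j E)‖ ≤
      2 * S.R) :
    ‖S.commonSignal lag w s j E - S.commonSignal lag w' s j E‖ < S.R ^ (S.D i j + 21) / 2 := by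
  have hR := S.le_R
  have hR0 := S.R_pos
  set p := S.privateSignal i (s * Tc + j) j (w i s) E -
    S.privateSignal i (s * Tc + j) j (w' i s) E
  set Δ := S.commonSignal lag w s j E - S.commonSignal lag w' s j E
  have hres : ‖Δ * dotT (H i) S.u + ((S.R ^ 12 : ℝ) : ℂ) * dotT (H i) p‖ ≤ 3 * S.R :=
    norm_residual_le hG i hpay hclose
  have hpriv : ‖((S.R ^ 12 : ℝ) : ℂ) * dotT (H i) p‖ ≤ S.R ^ (S.D i j + 18) := by
    calc ‖((S.R ^ 12 : ℝ) : ℂ) * dotT (H i) p‖ = S.R ^ 12 * ‖dotT (H i) p‖ :=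
          S.norm_ofReal_pow_mul _ _
      _ ≤ S.R ^ 12 * (S.R * S.R ^ (S.D i j + 5)) := by
          gcongr
          exact (norm_dotT_le _ _).trans (mul_le_mul (hG.norm_le i)
            (norm_privateSignal_sub_le hG i _ _) (norm_nonneg _) hR0.le)
      _ = S.R ^ (S.D i j + 18) := by ring
  have hnoise : 3 * S.R ≤ S.R ^ (S.D i j + 18) := by
    calc 3 * S.R ≤ S.R * S.R := by gcongr; linarith
      _ = S.R ^ 2 := (sq _).symm
      _ ≤ S.R ^ (S.D i j + 18) := pow_le_pow_right₀ S.one_le_R (by omega)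
  calc ‖Δ‖ ≤ ‖Δ‖ * (S.R * ‖dotT (H i) S.u‖) :=
        le_mul_of_one_le_right (norm_nonneg _) (hG.gain i)
    _ = S.R * ‖Δ * dotT (H i) S.u‖ := by rw [norm_mul]; ring
    _ ≤ S.R * (3 * S.R + S.R ^ (S.D i j + 18)) := by
        gcongr
        exact (norm_le_add_norm_add _ _).trans (add_le_add hres hpriv)
    _ ≤ S.R * (S.R ^ (S.D i j + 18) + S.R ^ (S.D i j + 18)) := by gcongr
    _ = 2 * S.R ^ (S.D i j + 19) := by ring
    _ < S.R ^ 2 / 2 * S.R ^ (S.D i j + 19) := by gcongr; nlinarith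
    _ = S.R ^ (S.D i j + 21) / 2 := by ring

end

variable {H : ℕ → Fin 2 → Vec M} {L : ℕ}

theorem payload_eq_of_close (i : Fin 2)
    (hG : ∀ j : Fin Tc, S.GoodSlot S.R (H ((s + lag) * Tc + j)) E ((s + lag) * Tc + j) j)
    (hpay : S.payload w (s + lag) E = S.payload w' (s + lag) E)
    (hclose : ∀ j : Fin Tc, ‖dotT (H ((s + lag) * Tc + j) i) (S.signal lag w (s + lag) j E) -
      dotT (H ((s + lag) * Tc + j) i) (S.signal lag w' (s + lag) j E)‖ ≤ 2 * S.R) :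
    S.payload w s E = S.payload w' s E := by
  refine S.emb.injective (funext fun k => ?_)
  obtain ⟨j, l, hlow, hhigh, rfl⟩ := S.rep_surj i k
  have hlt := norm_commonSignal_sub_lt (hG j) i hpay (hclose j)
  simp only [commonSignal, if_pos (Nat.le_add_left lag s), Nat.add_sub_cancel] at hlt
  exact eq_of_norm_superpose_sub_lt (by linarith [S.le_R]) S.four_mul_q_le hlt hlow hhigh

/-- Decoding is backwards: the payload of block `s`, which is needed to remove the disturbance in
that block, is conveyed by block `s + lag`. -/
theorem payload_eq_of_forall_close (hlag : 0 < lag) (i : Fin 2)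
    (hG : ∀ s < L + lag, ∀ j : Fin Tc, S.GoodSlot S.R (H (s * Tc + j)) E (s * Tc + j) j)
    (hend : ∀ v s, L ≤ s → w v s = w' v s)
    (hclose : ∀ s < L + lag, ∀ j : Fin Tc, ‖dotT (H (s * Tc + j) i) (S.signal lag w s j E) -
      dotT (H (s * Tc + j) i) (S.signal lag w' s j E)‖ ≤ 2 * S.R) (s : ℕ) :
    S.payload w s E = S.payload w' s E := by
  induction hn : L - s using Nat.strong_induction_on generalizing s with
  | _ n ih =>
    by_cases hs : L ≤ s
    · simp only [payload, hend _ _ hs]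
    · exact payload_eq_of_close i (hG _ (by omega)) (ih _ (by omega) _ rfl)
        (hclose _ (by omega))

theorem messages_eq_of_forall_close (hlag : 0 < lag) (i : Fin 2)
    (hG : ∀ s < L + lag, ∀ j : Fin Tc, S.GoodSlot S.R (H (s * Tc + j)) E (s * Tc + j) j)
    (hend : ∀ v s, L ≤ s → w v s = w' v s)
    (hclose : ∀ s < L + lag, ∀ j : Fin Tc, ‖dotT (H (s * Tc + j) i) (S.signal lag w s j E) -
      dotT (H (s * Tc + j) i) (S.signal lag w' s j E)‖ ≤ 2 * S.R) {s : ℕ} (hs : s < L) :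
    w i s = w' i s := by
  have hpay := payload_eq_of_forall_close hlag i hG hend hclose
  refine Prod.ext (funext fun j => ?_) (congrFun (congrArg Prod.snd (hpay s)) i)
  have hs' : s < L + lag := by omega
  have hcommon : S.commonSignal lag w s j E = S.commonSignal lag w' s j E := by
    simp only [commonSignal, hpay]
  have hres := norm_residual_le (hG s hs' j) i (hpay s) (hclose s hs' j)
  rw [hcommon, sub_self, zero_mul, zero_add, S.norm_ofReal_pow_mul] at hres
  have hdist := pow_mul_norm_disturbance_sub_le (hG s hs' j) i
    (congrFun (congrFun (congrArg Prod.fst (hpay s)) i) j)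
  exact symbols_eq_of_norm_dotT_privateSignal_sub_le (hG s hs' j) i hres
    (hdist.trans (by linarith [S.le_R]))

theorem norm_commonSignal_le : ‖S.commonSignal lag w s j E‖ ≤ S.R ^ (N - 2) := by
  unfold commonSignal
  split_ifs
  · exact norm_superpose_le (by linarith [S.le_R]) S.four_mul_q_le _ _
  · rw [norm_zero]; exact pow_nonneg S.R_pos.le _

theorem norm_signal_le {H : Fin 2 → Vec M} (hG : S.GoodSlot S.R H E (s * Tc + j) j) :
    ‖S.signal lag w s j E‖ ≤ S.R ^ N := by
  have hR := S.le_R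
  have := S.R_pos
  have hN : N - 2 + 2 = N := by have := S.D_add_le 0 0; omega
  have hcommon : ‖S.commonSignal lag w s j E • S.u‖ ≤ S.R ^ (N - 2) * S.R := by
    rw [norm_smul]
    exact mul_le_mul norm_commonSignal_le S.norm_u_le (norm_nonneg _) (by positivity)
  have hprivate : ∀ v, ‖((S.R ^ 12 : ℝ) : ℂ) • S.privateSignal v (s * Tc + j) j (w v s) E‖ ≤
      S.R ^ (N - 2) * S.R := fun v => by
    calc ‖((S.R ^ 12 : ℝ) : ℂ) • S.privateSignal v (s * Tc + j) j (w v s) E‖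
        ≤ S.R ^ 12 * S.R ^ (S.D v j + 5) := by
          rw [norm_smul, Complex.norm_real, Real.norm_of_nonneg (by positivity)]
          gcongr
          exact norm_privateSignal_le hG v _
      _ = S.R ^ (S.D v j + 17) := by ring
      _ ≤ S.R ^ (N - 2 + 1) :=
          pow_le_pow_right₀ S.one_le_R (by have := S.D_add_le v j; omega)
      _ = S.R ^ (N - 2) * S.R := pow_succ _ _
  calc ‖S.signal lag w s j E‖ ≤ S.R ^ (N - 2) * S.R + 2 * (S.R ^ (N - 2) * S.R) := by
        rw [signal, Fin.sum_univ_two, smul_add]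
        refine (norm_add_le _ _).trans (add_le_add hcommon ((norm_add_le _ _).trans ?_))
        linarith [hprivate 0, hprivate 1]
    _ = S.R ^ (N - 2) * S.R * 3 := by ring
    _ ≤ S.R ^ (N - 2) * S.R * S.R := by gcongr; linarith
    _ = S.R ^ N := by rw [mul_assoc, ← sq, ← pow_add, hN]

end Blocks

end Layout

/-! ### Codes from encoders with separated signals -/

theorem exists_measurable_select {X ι : Type*} [MeasurableSpace X] [MeasurableSpace ι]
    [Countable ι] [Nonempty ι] {S : ι → Set X} (hS : ∀ k, MeasurableSet (S k)) :
    ∃ f : X → ι, Measurable f ∧ ∀ x k, x ∈ S k → (∀ k', x ∈ S k' → k' = k) → f x = k := by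
  obtain ⟨f, hf, hfS⟩ := exists_measurable_piecewise
    (fun k => S k ∩ ⋂ k', {x | x ∈ S k' → k' = k})
    (fun k => (hS k).inter <| MeasurableSet.iInter fun k' =>
      measurableSet_setOfPred.2
        (Measurable.imp (measurableSet_setOfPred.1 (hS k')) measurable_const))
    (fun k _ => k) (fun _ => measurable_const)
    fun k k' _ x hx => Set.mem_iInter.1 hx.2.2 k hx.1.1
  exact ⟨f, hf, fun x k hx hk => hfS k ⟨hx, Set.mem_iInter.2 hk⟩⟩

namespace Code

variable {Ω : Type*} [MeasurableSpace Ω] {μ : Measure Ω} [IsProbabilityMeasure μ] {M n : ℕ}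
  (C : Code M n)

theorem sum_div_le {f : (∀ i, Fin (C.size i)) → ENNReal} {b : ENNReal} (hf : ∀ w, f w ≤ b) :
    (∑ w, f w) / ((C.size 0 * C.size 1 : ℕ) : ENNReal) ≤ b := by
  have hcard : (Finset.univ : Finset (∀ i, Fin (C.size i))).card = C.size 0 * C.size 1 := by
    simp [Fintype.card_pi]
  refine ENNReal.div_le_of_le_mul ((Finset.sum_le_card_nsmul _ _ b fun w _ => hf w).trans ?_)
  rw [nsmul_eq_mul, hcard, mul_comm]

theorem powerConstraint_of_norm_sq_le {P : ℝ} (hC : ∀ t w e, ‖C.enc t w e‖ ^ 2 ≤ P)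
    (est : Feedback Ω M) : C.PowerConstraint μ est P := by
  refine fun t => C.sum_div_le fun w => ?_
  refine (lintegral_mono (g := fun _ => ENNReal.ofReal P) fun ω => ?_).trans (by simp)
  rw [← ofReal_norm, ← ENNReal.ofReal_pow (norm_nonneg _)]
  exact ENNReal.ofReal_le_ofReal (hC _ _ _)

theorem errorProb_le {h : Channel Ω M} {est : Feedback Ω M} {P R : ℝ} {G : Set Ω}
    (hC : ∀ ω ∈ G, ∀ z, (∀ p, ‖z p‖ ≤ R) → ∀ w i,
      C.dec i (C.output h est P w i ω z, channels h ω, estimates est P ω) = w i) :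
    C.errorProb μ h est P ≤ μ Gᶜ +
      Measure.pi (fun _ : Fin 2 × Fin n => complexGaussian 1) {z | ¬ ∀ p, ‖z p‖ ≤ R} := by
  refine C.sum_div_le fun w => ?_
  have hsub : {p : Ω × (Fin 2 × Fin n → ℂ) | ∃ i, C.dec i
      (C.output h est P w i p.1 p.2, channels h p.1, estimates est P p.1) ≠ w i} ⊆
      Gᶜ ×ˢ Set.univ ∪ Set.univ ×ˢ {z | ¬ ∀ p, ‖z p‖ ≤ R} := by
    rintro ⟨ω, z⟩ ⟨i, hi⟩
    by_cases hω : ω ∈ G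
    · exact Or.inr ⟨trivial, fun hz => hi (hC ω hω z hz w i)⟩
    · exact Or.inl ⟨hω, trivial⟩
  refine (measure_mono hsub).trans ((measure_union_le _ _).trans ?_)
  simp only [Measure.prod_prod, measure_univ, mul_one, one_mul, le_refl]

end Code

/-- The transmitter's part of a code, for messages from arbitrary sets. -/
structure Encoder (M n : ℕ) (W : Fin 2 → Type) where
  enc : Fin n → (∀ i, W i) → (Fin n → Fin n → Fin 2 → Vec M) → Vec M
  measurable : ∀ t w, Measurable (enc t w)
  causal : ∀ t w e e', (∀ s t' i, t' ≤ t → e s t' i = e' s t' i) → enc t w e = enc t w e'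

/-- What a receiver observes: its received symbols, the channels and the estimates. -/
abbrev Observation (M n : ℕ) : Type :=
  (Fin n → ℂ) × (Fin n → Fin 2 → Vec M) × (Fin n → Fin n → Fin 2 → Vec M)

namespace Encoder

variable {M n : ℕ} {W : Fin 2 → Type} (X : Encoder M n W)

/-- The observations of receiver `i` that its message `v` explains, together with some message of
the other user, up to noise samples of size `R`. -/
def consistent (R : ℝ) (i : Fin 2) (v : W i) : Set (Observation M n) :=
  {p | ∃ w, w i = v ∧ ∀ t, ‖p.1 t - dotT (p.2.1 t i) (X.enc t w p.2.2)‖ ≤ R}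

theorem measurableSet_consistent [∀ i, Countable (W i)] (R : ℝ) (i : Fin 2) (v : W i) :
    MeasurableSet (X.consistent R i v) := by
  refine measurableSet_setOfPred.2 (Measurable.exists fun w => measurable_const.and
    (Measurable.forall fun t => measurableSet_setOfPred.1 (measurableSet_le ?_ measurable_const)))
  have hX : Measurable fun p : Observation M n => X.enc t w p.2.2 :=
    (X.measurable t w).comp (measurable_snd.comp measurable_snd)
  exact (Measurable.sub (by fun_prop) (measurable_dotT (by fun_prop) hX)).norm

variable [∀ i, Fintype (W i)] [∀ i, Nonempty (W i)]

/-- The code with a given encoder and given decoders, where messages are numbered. -/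
def toCode (dec : (i : Fin 2) → Observation M n → Fin (Fintype.card (W i)))
    (hdec : ∀ i, Measurable (dec i)) : Code M n where
  size i := Fintype.card (W i)
  size_pos _ := Fintype.card_pos
  enc t w := X.enc t fun i => (Fintype.equivFin (W i)).symm (w i)
  enc_measurable _ _ := X.measurable _ _
  enc_causal _ _ := X.causal _ _
  dec := dec
  dec_measurable := hdec

theorem exists_code {Ω : Type*} [MeasurableSpace Ω] {μ : Measure Ω} [IsProbabilityMeasure μ]
    {h : Channel Ω M} {est : Feedback Ω M} {P R : ℝ} (hpow : ∀ t w e, ‖X.enc t w e‖ ^ 2 ≤ P)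
    {G : Set Ω} (hsep : ∀ ω ∈ G, ∀ i w w',
      (∀ t : Fin n, ‖dotT (h t i ω) (X.enc t w (Code.estimates est P ω)) -
        dotT (h t i ω) (X.enc t w' (Code.estimates est P ω))‖ ≤ 2 * R) → w i = w' i) :
    ∃ C : Code M n, (∀ i, C.size i = Fintype.card (W i)) ∧ C.PowerConstraint μ est P ∧
      C.errorProb μ h est P ≤ μ Gᶜ +
        Measure.pi (fun _ : Fin 2 × Fin n => complexGaussian 1) {z | ¬ ∀ p, ‖z p‖ ≤ R} := by
  have : ∀ i, Nonempty (Fin (Fintype.card (W i))) := fun i => ⟨⟨0, Fintype.card_pos⟩⟩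
  choose dec hmeas hdec using fun i => exists_measurable_select fun k =>
    X.measurableSet_consistent R i ((Fintype.equivFin (W i)).symm k)
  refine ⟨X.toCode dec hmeas, fun i => rfl,
    Code.powerConstraint_of_norm_sq_le _ (fun t _ e => by
      simpa only [toCode] using hpow t _ e) est,
    Code.errorProb_le _ fun ω hω z hz w i => ?_⟩
  let v : ∀ i, W i := fun i => (Fintype.equivFin (W i)).symm (w i)
  have houtput : ∀ t, (X.toCode dec hmeas).output h est P w i ω z t =
      dotT (h t i ω) (X.enc t v (Code.estimates est P ω)) + z (i, t) := fun _ => rfl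
  refine hdec i _ (w i) ⟨v, rfl, fun t => ?_⟩ fun k ⟨w', hw', hclose⟩ => ?_
  · simp only [houtput, Code.channels, add_sub_cancel_left]
    exact hz (i, t)
  · refine (Fintype.equivFin (W i)).symm.injective (hw'.symm.trans ?_)
    refine hsep ω hω i w' v fun t => ?_
    have hle := hclose t
    simp only [houtput, Code.channels] at hle
    rw [norm_sub_rev, two_mul, ← add_sub_cancel_right (dotT _ _ - dotT _ _) (z (i, t)),
      ← add_sub_right_comm]
    exact (norm_sub_le _ _).trans (add_le_add hle (hz (i, t)))

end Encoder

theorem exists_powerConstraint {Ω : Type*} [MeasurableSpace Ω] (μ : Measure Ω)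
    [IsProbabilityMeasure μ] {M : ℕ} (n : ℕ) (est : Feedback Ω M) (P : ℝ) :
    ∃ C : Code M n, 0 ≤ P → C.PowerConstraint μ est P := by
  let X : Encoder M n fun _ => Unit := ⟨fun _ _ _ => 0, fun _ _ => measurable_const,
    fun _ _ _ _ _ => rfl⟩
  exact ⟨X.toCode (fun _ _ => ⟨0, Fintype.card_pos⟩) fun _ => measurable_const, fun hP =>
    Code.powerConstraint_of_norm_sq_le _ (fun _ _ _ => by simpa [Encoder.toCode, X]) est⟩

/-! ### The code of the block scheme -/

/-- The estimates exchanged during `n` slots, extended by zero to all slots. -/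
def extendEst {M n : ℕ} (e : Fin n → Fin n → Fin 2 → Vec M) : ℕ → ℕ → Fin 2 → Vec M :=
  fun s t v => if hst : s < n ∧ t < n then e ⟨s, hst.1⟩ ⟨t, hst.2⟩ v else 0

section ExtendEst

variable {M n : ℕ} {e e' : Fin n → Fin n → Fin 2 → Vec M} {s t : ℕ}

theorem measurable_extendEst (s t : ℕ) (v : Fin 2) :
    Measurable fun e : Fin n → Fin n → Fin 2 → Vec M => extendEst e s t v := by
  unfold extendEst
  split_ifs
  · fun_prop
  · exact measurable_const

theorem extendEst_congr (he : ∀ (s t' : Fin n) v, (t' : ℕ) ≤ t → e s t' v = e' s t' v) (v : Fin 2) :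
    extendEst e s t v = extendEst e' s t v := by
  unfold extendEst
  split_ifs
  · exact he _ _ _ le_rfl
  · rfl

theorem extendEst_estimates {Ω : Type*} (est : Feedback Ω M) (P : ℝ) (ω : Ω) (hs : s < n)
    (ht : t < n) (v : Fin 2) :
    extendEst (Code.estimates (n := n) est P ω) s t v = est P s t v ω :=
  dif_pos ⟨hs, ht⟩

end ExtendEst

/-- The vector `x`, or silence if `x` is longer than `r`. -/
def truncate {M : ℕ} (r : ℝ) (x : Vec M) : Vec M := if ‖x‖ ≤ r then x else 0

theorem norm_truncate_le {M : ℕ} {r : ℝ} (hr : 0 ≤ r) (x : Vec M) : ‖truncate r x‖ ≤ r := by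
  unfold truncate
  split_ifs with hx
  · exact hx
  · rwa [norm_zero]

theorem measurable_truncate {M : ℕ} (r : ℝ) : Measurable (truncate r : Vec M → Vec M) :=
  Measurable.ite (measurableSet_le measurable_norm measurable_const) measurable_id measurable_const

namespace Scheme

variable {M Tc N : ℕ} {Z : Scheme M Tc N}

theorem GoodSlot.congr {R : ℝ} {H : Fin 2 → Vec M} {E E' : ℕ → ℕ → Fin 2 → Vec M} {t : ℕ}
    {j : Fin Tc} (hG : Z.GoodSlot R H E t j) (hcur : ∀ v, E t t v = E' t t v)
    (hdel : ∀ v, E (Z.source t) (Z.arrival t) v = E' (Z.source t) (Z.arrival t) v) :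
    Z.GoodSlot R H E' t j where
  norm_le := hG.norm_le
  current v := hcur (1 - v) ▸ hG.current v
  delayed v := hdel (1 - v) ▸ hG.delayed v
  gain := hG.gain
  det := hG.det
  det_zeroForce := hG.det_zeroForce

/-- All slots of the first `B` blocks are good. -/
def AllGood {Ω : Type*} (Z : Scheme M Tc N) (h : Channel Ω M) (est : Feedback Ω M) (B : ℕ)
    (R P : ℝ) (ω : Ω) : Prop :=
  ∀ (s : Fin B) (j : Fin Tc), Z.GoodSlot R (fun v => h (s * Tc + j) v ω)
    (fun t t' v => est P t t' v ω) (s * Tc + j) j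

theorem mul_add_lt {s B : ℕ} (hs : s < B) (j : Fin Tc) : s * Tc + j < B * Tc :=
  (Nat.add_lt_add_left j.2 _).trans_le ((Nat.succ_mul s Tc).ge.trans (Nat.mul_le_mul_right _ hs))

end Scheme

namespace Layout

variable {M Tc N : ℕ} (S : Layout M Tc N)

section Measurability

variable {X : Type*} [MeasurableSpace X] {E : X → ℕ → ℕ → Fin 2 → Vec M}
  (hE : ∀ s t v, Measurable fun x => E x s t v)

include hE

theorem measurable_privateSignal (v : Fin 2) (t : ℕ) (j : Fin Tc) (m : S.Block v) :
    Measurable fun x => S.privateSignal v t j m (E x) := by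
  have hbeam : Measurable fun x => S.beam v t j (E x) := by
    unfold beam
    split_ifs
    · exact measurable_const
    · exact (measurable_zeroForce _).comp (hE _ _ _)
  unfold privateSignal
  exact (hbeam.const_smul (symbol (m.1 j).1)).add measurable_const

theorem measurable_commonSignal (lag : ℕ) (w : ∀ v, ℕ → S.Block v) (s : ℕ) (j : Fin Tc) :
    Measurable fun x => S.commonSignal lag w s j (E x) := by
  let _ : ∀ m, MeasurableSpace (ZMod m) := fun _ => ⊤
  have : ∀ m, MeasurableSingletonClass (ZMod m) := fun _ => ⟨fun _ => trivial⟩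
  have : NeZero S.q := ⟨S.q_pos.ne'⟩
  have hreport : ∀ v t (j : Fin Tc) m, Measurable fun x => S.report v t j m (E x) :=
    fun v t j m => (measurable_quantise _ _).comp
      (measurable_dotT (hE _ _ _) (S.measurable_privateSignal hE v t j m))
  have hpayload : ∀ s, Measurable fun x => S.payload w s (E x) := fun s =>
    (measurable_pi_lambda _ fun v => measurable_pi_lambda _ fun j => hreport v _ j _).prodMk
      measurable_const
  unfold commonSignal
  split_ifs
  · exact (measurable_of_countable fun p =>
      superpose S.R (N - 2) fun l => S.emb p (S.rep (j, l))).comp (hpayload _)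
  · exact measurable_const

theorem measurable_signal (lag : ℕ) (w : ∀ v, ℕ → S.Block v) (s : ℕ) (j : Fin Tc) :
    Measurable fun x => S.signal lag w s j (E x) := by
  have hprivate :
      Measurable fun x => ∑ v, S.privateSignal v (s * Tc + j) j (w v s) (E x) :=
    Finset.measurable_sum Finset.univ fun v _ => S.measurable_privateSignal hE v _ j (w v s)
  unfold signal
  exact ((S.measurable_commonSignal hE lag w s j).smul_const S.u).add
    (hprivate.const_smul ((S.R ^ 12 : ℝ) : ℂ))

end Measurability

section Causality

variable {E E' : ℕ → ℕ → Fin 2 → Vec M} {t : ℕ}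

variable {S} in
theorem privateSignal_congr (hE : ∀ v, E t t v = E' t t v) (v : Fin 2) (j : Fin Tc)
    (m : S.Block v) : S.privateSignal v t j m E = S.privateSignal v t j m E' := by
  simp only [privateSignal, beam, hE]

variable {S} in
/-- The payload of block `s - lag` is available in block `s`, since all that it reports on has
arrived by then. -/
theorem commonSignal_congr {lag : ℕ} (hlag : Tc + S.delay ≤ lag * Tc) (w : ∀ v, ℕ → S.Block v)
    (s : ℕ) (j : Fin Tc) (hE : ∀ x t v, t ≤ s * Tc → E x t v = E' x t v) :
    S.commonSignal lag w s j E = S.commonSignal lag w s j E' := by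
  unfold commonSignal
  split_ifs with hs
  · have hslot : ∀ j' : Fin Tc, (s - lag) * Tc + j' + S.delay ≤ s * Tc := fun j' => by
      have hmul : (s - lag) * Tc + lag * Tc = s * Tc := by rw [← add_mul, Nat.sub_add_cancel hs]
      have := j'.2
      omega
    have hpayload : S.payload w (s - lag) E = S.payload w (s - lag) E' := by
      refine Prod.ext (funext fun v => funext fun j' => ?_) rfl
      have hpriv :=
        privateSignal_congr (fun v => hE _ _ v ((Nat.le_add_right _ _).trans (hslot j'))) v j'
          (w v (s - lag))
      simp only [payload, report, hpriv, hE _ _ _ ((S.arrival_le _).trans (hslot j'))]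
    rw [hpayload]
  · rfl

variable {S} in
theorem signal_congr {lag : ℕ} (hlag : Tc + S.delay ≤ lag * Tc) (w : ∀ v, ℕ → S.Block v)
    (s : ℕ) (j : Fin Tc) (hE : ∀ x t v, t ≤ s * Tc + j → E x t v = E' x t v) :
    S.signal lag w s j E = S.signal lag w s j E' := by
  simp only [signal, privateSignal_congr fun v => hE _ _ v le_rfl,
    commonSignal_congr hlag w s j fun x t v ht => hE x t v (ht.trans (Nat.le_add_right _ _))]

end Causality

variable {L n : ℕ}

/-- The messages of `L` blocks, followed by fixed messages. -/
def extendMessages (w : ∀ v, Fin L → S.Block v) (v : Fin 2) : ℕ → S.Block v :=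
  Function.extend Fin.val (w v) fun _ => Classical.arbitrary _

theorem extendMessages_val (w : ∀ v, Fin L → S.Block v) (v : Fin 2) (s : Fin L) :
    S.extendMessages w v s = w v s :=
  Fin.val_injective.extend_apply _ _ _

theorem extendMessages_eq_of_le (w w' : ∀ v, Fin L → S.Block v) (v : Fin 2) {s : ℕ} (hs : L ≤ s) :
    S.extendMessages w v s = S.extendMessages w' v s := by
  have hrange : ¬ ∃ k : Fin L, (k : ℕ) = s := fun ⟨k, hk⟩ => (hk ▸ k.2).not_ge hs
  rw [extendMessages, extendMessages, Function.extend_apply' _ _ _ hrange,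
    Function.extend_apply' _ _ _ hrange]

theorem card_messages (v : Fin 2) :
    Fintype.card (Fin L → S.Block v) = S.q ^ (L * S.total v) := by
  rw [Fintype.card_fun, Fintype.card_fin, Fintype.card_prod, Fintype.card_pi, Fintype.card_fin,
    mul_comm L, pow_mul, DigitAllocation.total, pow_add, Finset.sum_range,
    ← Finset.prod_pow_eq_pow_sum]
  congr 2
  refine Finset.prod_congr rfl fun j _ => ?_
  simp only [Fintype.card_prod, Fintype.card_fin]
  ring

/-- What is sent in slot `t` of all, as long as it respects the power constraint. -/
def transmit (lag : ℕ) (w : ∀ v, ℕ → S.Block v) (t : ℕ) (E : ℕ → ℕ → Fin 2 → Vec M) : Vec M :=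
  truncate (S.R ^ N) (S.signal lag w (t / Tc) ⟨t % Tc, Nat.mod_lt t S.Tc_pos⟩ E)

variable {S} in
theorem transmit_eq_signal {lag s : ℕ} {j : Fin Tc} {w : ∀ v, ℕ → S.Block v} {H : Fin 2 → Vec M}
    {E : ℕ → ℕ → Fin 2 → Vec M} (hG : S.GoodSlot S.R H E (s * Tc + j) j) :
    S.transmit lag w (s * Tc + j) E = S.signal lag w s j E := by
  have hdiv : (s * Tc + j) / Tc = s := by
    rw [mul_comm, Nat.mul_add_div S.Tc_pos, Nat.div_eq_of_lt j.2, add_zero]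
  have hmod : (⟨(s * Tc + j) % Tc, Nat.mod_lt _ S.Tc_pos⟩ : Fin Tc) = j :=
    Fin.ext (Nat.mul_add_mod_of_lt j.2)
  rw [transmit, hdiv, hmod, truncate, if_pos (norm_signal_le hG)]

/-- The encoder of the block scheme, where the payload of a block is sent as soon as the estimates
that it is computed from must have arrived. -/
def encoder (L n : ℕ) : Encoder M n fun v => Fin L → S.Block v where
  enc t w e := S.transmit (S.delay + 1) (S.extendMessages w) t (extendEst e)
  measurable t w := (measurable_truncate _).comp
    (S.measurable_signal measurable_extendEst _ _ _ _)
  causal t w e e' he := by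
    have hlag : Tc + S.delay ≤ (S.delay + 1) * Tc := by
      nlinarith [S.Tc_pos]
    refine congrArg (truncate (S.R ^ N)) (signal_congr hlag _ _ _ fun x t' v ht' => ?_)
    rw [Nat.div_add_mod'] at ht'
    exact extendEst_congr (fun s t'' i ht'' => he s t'' i (Fin.le_def.2 (ht''.trans ht'))) v

theorem exists_code {Ω : Type*} [MeasurableSpace Ω] (μ : Measure Ω) [IsProbabilityMeasure μ]
    (h : Channel Ω M) (est : Feedback Ω M) (hn : (L + (S.delay + 1)) * Tc + S.delay ≤ n) {P : ℝ}
    (hP : (S.R ^ N) ^ 2 = P) :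
    ∃ C : Code M n, (∀ v, C.size v = S.q ^ (L * S.total v)) ∧ C.PowerConstraint μ est P ∧
      C.errorProb μ h est P ≤ μ {ω | ¬ S.AllGood h est (L + (S.delay + 1)) S.R P ω} +
        Measure.pi (fun _ : Fin 2 × Fin n => complexGaussian 1) {z | ¬ ∀ p, ‖z p‖ ≤ S.R} := by
  simp only [← card_messages]
  refine (S.encoder L n).exists_code (fun t w e => hP ▸ pow_le_pow_left₀ (norm_nonneg _)
    (norm_truncate_le (pow_nonneg S.R_pos.le N) _) 2)
    (G := {ω | S.AllGood h est (L + (S.delay + 1)) S.R P ω}) fun ω hω i w w' hclose => ?_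
  set E := extendEst (Code.estimates (n := n) est P ω)
  have hG : ∀ s < L + (S.delay + 1), ∀ j : Fin Tc,
      S.GoodSlot S.R (fun v => h (s * Tc + j) v ω) E (s * Tc + j) j := fun s hs j => by
    have ht := Scheme.mul_add_lt hs j
    have hsource := S.source_le (s * Tc + j)
    have harrival := S.arrival_le (s * Tc + j)
    have hcur : s * Tc + j < n := by omega
    have hsource' : S.source (s * Tc + j) < n := by omega
    have harrival' : S.arrival (s * Tc + j) < n := by omega
    exact (hω ⟨s, hs⟩ j).congr (fun v => (extendEst_estimates est P ω hcur hcur v).symm)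
      fun v => (extendEst_estimates est P ω hsource' harrival' v).symm
  refine funext fun s => ?_
  rw [← S.extendMessages_val w i s, ← S.extendMessages_val w' i s]
  refine messages_eq_of_forall_close (lag := S.delay + 1) (Nat.succ_pos _) i
    (H := fun t v => h t v ω) hG
    (fun v s hs => S.extendMessages_eq_of_le w w' v hs) (fun s hs j => ?_) s.2
  have ht := Scheme.mul_add_lt hs j
  have hsignal : ∀ w, S.transmit (S.delay + 1) w (s * Tc + j) E =
      S.signal (S.delay + 1) w s j E := fun w => transmit_eq_signal (hG s hs j)
  rw [← hsignal, ← hsignal]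
  exact hclose ⟨s * Tc + j, by omega⟩

end Layout

/-! ### Schemes and codes at large powers -/

namespace DigitAllocation

variable {Tc N : ℕ} (A : DigitAllocation Tc N)

theorem N_pos (A : DigitAllocation Tc N) : 0 < N := by
  have := A.D_add_le 0 0
  omega

theorem exists_repetition : ∃ rep : Fin Tc × ℕ → Fin A.K, ∀ v k, ∃ (j : Fin Tc) (l : ℕ),
    A.D v j + 21 ≤ l ∧ l < N - 2 ∧ rep (j, l) = k := by
  let T : Fin 2 → Finset (Σ _ : Fin Tc, ℕ) := fun v =>
    Finset.univ.sigma fun j => Finset.Ico (A.D v j + 21) (N - 2)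
  have hcard : ∀ v, A.K ≤ (T v).card := fun v => by
    rw [Finset.card_sigma]
    refine (A.room v).trans_eq ((Finset.sum_range _).trans (Finset.sum_congr rfl fun j _ => ?_))
    rw [Nat.card_Ico]; omega
  obtain ⟨r, hr₀, hr₁⟩ := exists_map_surjOn_two (T 0) (T 1) A.K_pos (hcard 0) (hcard 1)
  have hr : ∀ v k, ∃ p ∈ T v, r p = k := Fin.forall_fin_two.2 ⟨hr₀, hr₁⟩
  refine ⟨fun p => r ⟨p.1, p.2⟩, fun v k => ?_⟩
  obtain ⟨⟨j, l⟩, hp, hk⟩ := hr v k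
  obtain ⟨hlow, hhigh⟩ := Finset.mem_Ico.1 (Finset.mem_sigma.1 hp).2
  exact ⟨j, l, hlow, hhigh, hk⟩

theorem card_payload (q : ℕ) [NeZero q] : Fintype.card (A.Payload q) =
    q ^ ∑ v, (∑ j ∈ Finset.range Tc, 2 * (A.D v j - A.a v j + 18) + A.f v) := by
  simp only [Payload, Fintype.card_prod, Fintype.card_pi, Fintype.card_fin, ZMod.card,
    Finset.sum_range, ← Finset.prod_pow_eq_pow_sum, pow_add, Finset.prod_mul_distrib, two_mul]

theorem nonempty_payload_embedding {q : ℕ} (hq : 0 < q) :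
    Nonempty (A.Payload q ↪ (Fin A.K → Fin q × Fin q)) := by
  have : NeZero q := ⟨hq.ne'⟩
  refine Function.Embedding.nonempty_of_card_le ?_
  rw [A.card_payload, Fintype.card_fun, Fintype.card_prod, Fintype.card_fin, Fintype.card_fin,
    ← sq, ← pow_mul]
  exact Nat.pow_le_pow_right hq A.budget

end DigitAllocation

theorem eventually_pow_le_floor_pow (N : ℕ) : ∀ᶠ R : ℝ in atTop, ∀ k ≤ N,
    R ^ (k + 17) ≤ (⌊R / 4⌋₊ : ℝ) ^ (k + 18) := by
  filter_upwards [eventually_ge_atTop ((8 : ℝ) ^ (N + 18))] with R hR k hk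
  have h8 : (8 : ℝ) ≤ R := (le_self_pow₀ (by norm_num) (by omega)).trans hR
  have hfloor : R / 8 ≤ (⌊R / 4⌋₊ : ℝ) := by linarith [Nat.lt_floor_add_one (R / 4)]
  have hpow : (8 : ℝ) ^ (k + 18) ≤ R :=
    (pow_le_pow_right₀ (by norm_num) (by omega)).trans hR
  calc R ^ (k + 17) = R ^ (k + 17) * 8 ^ (k + 18) / 8 ^ (k + 18) := by field_simp
    _ ≤ R ^ (k + 17) * R / 8 ^ (k + 18) := by gcongr
    _ = (R / 8) ^ (k + 18) := by rw [div_pow, ← pow_succ]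
    _ ≤ (⌊R / 4⌋₊ : ℝ) ^ (k + 18) := by gcongr

theorem tendsto_log_floor_radix {N : ℕ} (hN : 0 < N) :
    Tendsto (fun P => Real.log ⌊radix N P / 4⌋₊ / Real.log P) atTop (𝓝 (1 / (2 * (N : ℝ)))) := by
  have hR := tendsto_radix hN
  have hratio : Tendsto (fun P => Real.log (⌊radix N P / 4⌋₊ / radix N P)) atTop
      (𝓝 (Real.log (1 / 4))) := by
    simpa only [Function.comp_def, div_mul_eq_mul_div, one_mul] using
      ((tendsto_nat_floor_mul_div_atTop (R := ℝ) (by norm_num : (0 : ℝ) ≤ 1 / 4)).comp hR).log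
        (by norm_num)
  have hsum : Tendsto (fun P => Real.log (⌊radix N P / 4⌋₊ / radix N P) / Real.log P +
      1 / (2 * (N : ℝ))) atTop (𝓝 (1 / (2 * (N : ℝ)))) := by
    simpa only [zero_add] using (hratio.div_atTop Real.tendsto_log_atTop).add_const _
  refine hsum.congr' ?_
  filter_upwards [hR.eventually_ge_atTop 4, eventually_gt_atTop 1] with P h4 hP
  have hfloor : (⌊radix N P / 4⌋₊ : ℝ) ≠ 0 :=
    Nat.cast_ne_zero.2 (Nat.floor_pos.2 (by linarith)).ne'
  have hlog : Real.log (radix N P) = 1 / (2 * (N : ℝ)) * Real.log P := by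
    rw [radix, Real.log_rpow (one_pos.trans hP)]
  rw [Real.log_div hfloor (by linarith), hlog, sub_div,
    mul_div_cancel_right₀ _ (Real.log_pos hP).ne', sub_add_cancel]

theorem Code.tendsto_rate_div_logb {M N n m : ℕ} (hN : 0 < N) {C : ℝ → Code M n} {i : Fin 2}
    (hC : ∀ᶠ P in atTop, (C P).size i = ⌊radix N P / 4⌋₊ ^ m) :
    Tendsto (fun P => (C P).rate i / Real.logb 2 P) atTop (𝓝 (m / (2 * N * n))) := by
  have hlim := (tendsto_log_floor_radix hN).const_mul (m / n : ℝ)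
  rw [div_mul_div_comm, mul_one, mul_comm (n : ℝ)] at hlim
  refine hlim.congr' ?_
  filter_upwards [hC] with P hP
  rw [Code.rate, hP, Nat.cast_pow, div_right_comm, Real.logb, Real.logb,
    div_div_div_cancel_right₀ (Real.log_pos one_lt_two).ne', Real.log_pow]
  ring

namespace Scheme

variable {Ω : Type*} [MeasurableSpace Ω] {μ : Measure Ω} [IsProbabilityMeasure μ] {M Tc N : ℕ}
  {h : Channel Ω M} {est : Feedback Ω M}

theorem withHighProb_goodSlot (Z : Scheme M Tc N) {t : ℕ} {j : Fin Tc}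
    (hm : ∀ v, Measurable (h t v)) {γ δ : Fin 2 → ℝ}
    (hcur : ∀ v, HasQualityExponent (fun P => mse μ h est P t t v) (γ v))
    (hdel : ∀ v, HasQualityExponent
      (fun P => ∫ ω, ‖h t v ω - est P (Z.source t) (Z.arrival t) v ω‖ ^ 2 ∂μ) (δ v))
    (ha : ∀ v, Z.a v j = 0 ∨ (Z.a v j : ℝ) + 20 ≤ N * γ (1 - v))
    (hD : ∀ v, Z.D v j = 0 ∨ (Z.D v j : ℝ) + 20 ≤ N * δ (1 - v))
    (hgen : ∀ v, (∀ᵐ ω ∂μ, dotT (h t v ω) Z.u ≠ 0) ∧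
      (∀ᵐ ω ∂μ, beamDet (h t v ω) (h t (1 - v) ω) Z.b Z.u ≠ 0) ∧
      (∀ᵐ ω ∂μ, beamDet (h t v ω) (h t (1 - v) ω) (zeroForce Z.b (h t (1 - v) ω)) Z.u ≠ 0)) :
    WithHighProb μ fun P ω => Z.GoodSlot (radix N P) (fun v => h t v ω)
      (fun s t' v => est P s t' v ω) t j := by
  have hR := tendsto_radix Z.N_pos
  have hnorm := WithHighProb.forall_finite fun v =>
    WithHighProb.le_of_tendsto_atTop (μ := μ) hR (hm v).norm
  have hcurrent := WithHighProb.forall_finite fun v =>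
    WithHighProb.or_of_not fun hne : ¬ Z.a v j = 0 =>
      (hcur (1 - v)).withHighProb_norm_mul_radix_pow_le Z.N_pos
        (e := fun P ω => h t (1 - v) ω - est P t t (1 - v) ω) (m := Z.a v j + 7)
        (by push_cast; linarith [(ha v).resolve_left hne])
  have hdelayed := WithHighProb.forall_finite fun v =>
    WithHighProb.or_of_not fun hne : ¬ Z.D v j = 0 =>
      (hdel (1 - v)).withHighProb_norm_mul_radix_pow_le Z.N_pos (m := Z.D v j + 17)
        (by push_cast; linarith [(hD v).resolve_left hne])
  have hgain := WithHighProb.forall_finite fun v =>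
    WithHighProb.le_mul_norm hR (measurable_dotT (hm v) measurable_const) (hgen v).1 1
  have hdet := WithHighProb.forall_finite fun v =>
    WithHighProb.le_mul_norm hR (measurable_beamDet (hm v) (hm (1 - v)) measurable_const Z.u)
      (hgen v).2.1 1
  have hdet' := WithHighProb.forall_finite fun v =>
    WithHighProb.le_mul_norm hR (measurable_beamDet (hm v) (hm (1 - v))
      ((measurable_zeroForce Z.b).comp (hm (1 - v))) Z.u) (hgen v).2.2 2
  exact (hnorm.and <| hcurrent.and <| hdelayed.and <| hgain.and <| hdet.and hdet').mono
    fun P ω ⟨h₁, h₂, h₃, h₄, h₅, h₆⟩ => ⟨h₁, h₂, h₃, h₄, h₅, h₆⟩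

theorem eventually_exists_layout (Z : Scheme M Tc N) : ∀ᶠ P in atTop, ∃ S : Layout M Tc N,
    S.toScheme = Z ∧ S.R = radix N P ∧ S.q = ⌊radix N P / 4⌋₊ := by
  have hR := tendsto_radix Z.N_pos
  filter_upwards [hR.eventually_ge_atTop 12, hR.eventually (eventually_pow_le_floor_pow N),
    hR.eventually_ge_atTop ‖Z.u‖, hR.eventually_ge_atTop ‖Z.b‖] with P h12 hpow hu hb
  obtain ⟨emb⟩ := Z.nonempty_payload_embedding (q := ⌊radix N P / 4⌋₊)
    (Nat.floor_pos.2 (by linarith))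
  have hq : 4 * (⌊radix N P / 4⌋₊ : ℝ) ≤ radix N P := by
    linarith [Nat.floor_le (by linarith : 0 ≤ radix N P / 4)]
  exact ⟨{ Z with
    q := ⌊radix N P / 4⌋₊
    R := radix N P
    emb := emb
    le_R := h12
    four_mul_q_le := hq
    pow_R_le := hpow
    norm_u_le := hu
    norm_b_le := hb }, rfl, rfl, rfl⟩

theorem eventually_exists_code (Z : Scheme M Tc N) (μ : Measure Ω) [IsProbabilityMeasure μ]
    (h : Channel Ω M) (est : Feedback Ω M) {L n : ℕ}
    (hn : (L + (Z.delay + 1)) * Tc + Z.delay ≤ n) :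
    ∀ᶠ P in atTop, ∃ C : Code M n, C.PowerConstraint μ est P ∧
      (∀ v, C.size v = ⌊radix N P / 4⌋₊ ^ (L * Z.total v)) ∧
      C.errorProb μ h est P ≤
        μ {ω | ¬ Z.AllGood h est (L + (Z.delay + 1)) (radix N P) P ω} +
          Measure.pi (fun _ : Fin 2 × Fin n => complexGaussian 1)
            {z | ¬ ∀ p, ‖z p‖ ≤ radix N P} := by
  filter_upwards [Z.eventually_exists_layout, eventually_ge_atTop 0] with P ⟨S, hS, hR, hq⟩ hP
  subst hS
  rw [← hq, ← hR]
  obtain ⟨C, hsize, hpow, herr⟩ :=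
    S.exists_code μ h est hn (P := P) (hR ▸ radix_pow_sq S.N_pos hP)
  exact ⟨C, hpow, hsize, herr⟩

end Scheme

section Achievability

variable {Ω : Type*} [MeasurableSpace Ω] {μ : Measure Ω} [IsProbabilityMeasure μ] {M Tc : ℕ}
  {h : Channel Ω M} {est : Feedback Ω M}

theorem exists_codes_of_eventually {n : ℕ} {p : ℝ → Code M n → Prop}
    (hp : ∀ᶠ P in atTop, ∃ C : Code M n, C.PowerConstraint μ est P ∧ p P C) :
    ∃ C : ℝ → Code M n, (∀ P, 0 < P → (C P).PowerConstraint μ est P) ∧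
      ∀ᶠ P in atTop, p P (C P) := by
  have hcode : ∀ P, ∃ C : Code M n, (0 < P → C.PowerConstraint μ est P) ∧
      ((∃ C : Code M n, C.PowerConstraint μ est P ∧ p P C) → p P C) := fun P => by
    by_cases hP : ∃ C : Code M n, C.PowerConstraint μ est P ∧ p P C
    · obtain ⟨C, hpow, hC⟩ := hP
      exact ⟨C, fun _ => hpow, fun _ => hC⟩
    · obtain ⟨C, hpow⟩ := exists_powerConstraint μ n est P
      exact ⟨C, fun hP0 => hpow hP0.le, fun hC => absurd hC hP⟩
  choose C hpow hC using hcode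
  exact ⟨C, hpow, hp.mono hC⟩

theorem Scheme.exists_codes {N : ℕ} (Z : Scheme M Tc N) {L n : ℕ}
    (hn : (L + (Z.delay + 1)) * Tc + Z.delay ≤ n)
    (hgood : WithHighProb μ fun P =>
      Z.AllGood h est (L + (Z.delay + 1)) (radix N P) P) :
    ∃ C : ℝ → Code M n, (∀ P, 0 < P → (C P).PowerConstraint μ est P) ∧
      (∀ v, Tendsto (fun P => (C P).rate v / Real.logb 2 P) atTop
        (𝓝 ((L * Z.total v : ℕ) / (2 * N * n)))) ∧
      Tendsto (fun P => (C P).errorProb μ h est P) atTop (𝓝 0) := by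
  obtain ⟨C, hpow, hC⟩ := exists_codes_of_eventually (Z.eventually_exists_code μ h est hn)
  have hnoise : WithHighProb (Measure.pi fun _ : Fin 2 × Fin n => complexGaussian 1)
      fun P z => ∀ p, ‖z p‖ ≤ radix N P :=
    WithHighProb.forall_finite fun p =>
      WithHighProb.le_of_tendsto_atTop (tendsto_radix Z.N_pos) (measurable_pi_apply p).norm
  have herr := Tendsto.add hgood hnoise
  rw [add_zero] at herr
  exact ⟨C, hpow, fun v => Code.tendsto_rate_div_logb Z.N_pos (hC.mono fun P hP => hP.1 v),
    tendsto_of_tendsto_of_tendsto_of_le_of_le' tendsto_const_nhds herr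
      (Eventually.of_forall fun _ => zero_le) (hC.mono fun P hP => hP.2)⟩

theorem tendsto_div_sub_div {k : ℕ} (hk : 0 < k) (c : ℕ) :
    Tendsto (fun n : ℕ => ((n / k - c : ℕ) : ℝ) / n) atTop (𝓝 (1 / k)) := by
  have hlim : Tendsto (fun n : ℕ => (⌊(1 / k : ℝ) * n⌋₊ : ℝ) / n - c / n) atTop (𝓝 (1 / k)) := by
    simpa only [Function.comp_def, sub_zero] using
      ((tendsto_nat_floor_mul_div_atTop (R := ℝ) (by positivity)).comp
        tendsto_natCast_atTop_atTop).sub (tendsto_const_div_atTop_nhds_zero_nat (c : ℝ))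
  refine hlim.congr' ?_
  filter_upwards [eventually_ge_atTop (c * k)] with n hn
  rw [Nat.cast_sub ((Nat.le_div_iff_mul_le hk).2 hn), one_div_mul_eq_div, Nat.floor_div_eq_div,
    sub_div]

theorem achievableDoF_of_schemes (hTc : 0 < Tc) {d : Fin 2 → ℝ}
    (hZ : ∀ ε > 0, ∃ (N : ℕ) (Z : Scheme M Tc N), (∀ v, 2 * (d v - ε) * Tc * N < Z.total v) ∧
      ∀ B, WithHighProb μ fun P => Z.AllGood h est B (radix N P) P) :
    AchievableDoF μ h est d := by
  intro ε hε
  obtain ⟨N, Z, htotal, hgood⟩ := hZ ε hε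
  set lag := Z.delay + 1
  have hrate : ∀ v, ∀ᶠ n : ℕ in atTop,
      d v - ε ≤ ((n / Tc - 2 * lag) * Z.total v : ℕ) / (2 * N * n : ℝ) := fun v => by
    have hlim := (tendsto_div_sub_div hTc (2 * lag)).mul_const (Z.total v / (2 * N) : ℝ)
    have hlt : d v - ε < 1 / Tc * (Z.total v / (2 * N)) := by
      have hN : (0 : ℝ) < N := by exact_mod_cast Z.N_pos
      have : (0 : ℝ) < Tc := by exact_mod_cast hTc
      rw [div_mul_div_comm, one_mul, lt_div_iff₀ (by positivity)]
      linarith [htotal v]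
    filter_upwards [hlim.eventually_const_lt hlt] with n hn
    refine hn.le.trans_eq ?_
    push_cast
    rw [div_mul_div_comm, mul_comm (n : ℝ)]
  obtain ⟨n₀, hn₀⟩ := eventually_atTop.1
    ((eventually_all.2 hrate).and (eventually_ge_atTop (2 * lag * Tc)))
  refine ⟨n₀, fun n hn => ?_⟩
  obtain ⟨hrate, hlarge⟩ := hn₀ n hn
  have hblocks : n / Tc - 2 * lag + 2 * lag = n / Tc :=
    Nat.sub_add_cancel ((Nat.le_div_iff_mul_le hTc).2 hlarge)
  have hfit : (n / Tc - 2 * lag + lag) * Tc + Z.delay ≤ n := by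
    calc _ ≤ (n / Tc - 2 * lag + lag) * Tc + lag * Tc := by
          gcongr
          exact (Nat.le_succ _).trans (Nat.le_mul_of_pos_right _ hTc)
      _ = n / Tc * Tc := by rw [← add_mul, add_assoc, ← two_mul, hblocks]
      _ ≤ n := Nat.div_mul_le_self n Tc
  obtain ⟨C, hpow, hlim, herr⟩ := Z.exists_codes hfit (hgood _)
  exact ⟨C, hpow, fun v => ⟨_, hrate v, hlim v⟩, herr⟩

end Achievability

/-! ### Achievability from quality exponents -/

theorem exists_digitAllocation {Tc : ℕ} (hTc : 0 < Tc) {α : Fin 2 → ℕ → ℝ} {β : Fin 2 → ℝ}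
    {d ε : ℝ} (h0 : ∀ v j, 0 ≤ α v j) (hb : ∀ v j, α v j ≤ β v) (hβ : ∀ v, β v ≤ 1)
    (hα : ∀ v, 3 * d - 2 ≤ (∑ j ∈ Finset.range Tc, α v j) / Tc) (hdb : ∀ v, 2 * d - 1 ≤ β v)
    (hε : 0 < ε) :
    ∃ (N : ℕ) (A : DigitAllocation Tc N),
      (∀ v j, A.D v j = 0 ∨ (A.D v j : ℝ) + 20 ≤ N * β v) ∧
      (∀ v j, A.a v j = 0 ∨ (A.a v j : ℝ) + 20 ≤ N * α v j) ∧
      ∀ v, 2 * (d - ε) * Tc * N < A.total v := by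
  have hT : (0 : ℝ) < Tc := by exact_mod_cast hTc
  have hd : d ≤ 1 := by linarith [hdb 0, hβ 0]
  have hc : max (1 / 2) (d - ε / 2) < 1 := max_lt (by norm_num) (by linarith)
  have hα' : ∀ v, (3 * max (1 / 2) (d - ε / 2) - 2) * Tc < ∑ j ∈ Finset.range Tc, α v j :=
    fun v => (lt_div_iff₀ hT).1 <| by
      have hmean : 0 ≤ (∑ j ∈ Finset.range Tc, α v j) / Tc :=
        div_nonneg (Finset.sum_nonneg fun j _ => h0 v j) hT.le
      rcases max_choice (1 / 2) (d - ε / 2) with hmax | hmax <;> rw [hmax] <;>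
        linarith [hα v]
  have hdb' : ∀ v, 2 * max (1 / 2) (d - ε / 2) - 1 ≤ β v := fun v => by
    have hβ0 : 0 ≤ β v := (h0 v 0).trans (hb v 0)
    rcases max_choice (1 / 2) (d - ε / 2) with hmax | hmax <;> rw [hmax] <;> linarith [hdb v]
  obtain ⟨N, A, hD, ha, htotal⟩ := (eventually_exists_digitAllocation h0 hb hβ
    (le_max_left _ _) hc hα' hdb' (half_pos hε)).exists
  refine ⟨N, A, hD, ha, fun v => lt_of_le_of_lt ?_ (htotal v)⟩
  gcongr 2 * ?_ * _ * _
  linarith [le_max_right (1 / 2 : ℝ) (d - ε / 2)]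

section Exponents

variable {Ω : Type*} [MeasurableSpace Ω] {μ : Measure Ω} [IsProbabilityMeasure μ] {M Tc : ℕ}
  {h : Channel Ω M} {est : Feedback Ω M} {α : Fin 2 → ℕ → ℝ} {β : Fin 2 → ℝ} {d : ℝ}
  {source arrival : ℕ → ℕ} {delay : ℕ}

theorem exists_scheme {N : ℕ} (A : DigitAllocation Tc N) (hm : ∀ t i, Measurable (h t i))
    (hli : ∀ t, ∀ᵐ ω ∂μ, LinearIndependent ℂ (fun i : Fin 2 => h t i ω))
    (hcur : ∀ t v, HasQualityExponent (fun P => mse μ h est P t t v) (α v t))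
    (hper : ∀ v, Function.Periodic (α v) Tc)
    (hsource : ∀ t, source t ≤ t + delay) (harrival : ∀ t, arrival t ≤ t + delay)
    (hdelayed : ∀ t v, HasQualityExponent
      (fun P => ∫ ω, ‖h t v ω - est P (source t) (arrival t) v ω‖ ^ 2 ∂μ) (β v))
    (hD : ∀ v j, A.D v j = 0 ∨ (A.D v j : ℝ) + 20 ≤ N * β (1 - v))
    (ha : ∀ v j, A.a v j = 0 ∨ (A.a v j : ℝ) + 20 ≤ N * α (1 - v) j) :
    ∃ Z : Scheme M Tc N, Z.toDigitAllocation = A ∧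
      ∀ B, WithHighProb μ fun P => Z.AllGood h est B (radix N P) P := by
  obtain ⟨u, b, hgen⟩ := exists_generic_beams hm hli
  obtain ⟨rep, hrep⟩ := A.exists_repetition
  let Z : Scheme M Tc N :=
    { A with
      u := u
      b := b
      source := source
      arrival := arrival
      delay := delay
      source_le := hsource
      arrival_le := harrival
      rep := rep
      rep_surj := hrep }
  refine ⟨Z, rfl, fun B => WithHighProb.forall_finite fun s => WithHighProb.forall_finite fun j =>
    Z.withHighProb_goodSlot (hm _) (hcur _) (hdelayed _) (fun v => ?_) (fun v => hD v j)
      (hgen _)⟩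
  have hαj : α (1 - v) (s * Tc + j) = α (1 - v) j := by
    rw [add_comm]
    exact (hper (1 - v)).nsmul s j
  rw [hαj]
  exact ha v j

theorem achievableDoF_of_exponents (hTc : 0 < Tc) (hm : ∀ t i, Measurable (h t i))
    (hli : ∀ t, ∀ᵐ ω ∂μ, LinearIndependent ℂ (fun i : Fin 2 => h t i ω))
    (hcur : ∀ t v, HasQualityExponent (fun P => mse μ h est P t t v) (α v t))
    (hper : ∀ v, Function.Periodic (α v) Tc) (h0 : ∀ v t, 0 ≤ α v t)
    (hαβ : ∀ v t, α v t ≤ β v) (hβ1 : ∀ v, β v ≤ 1)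
    (hsource : ∀ t, source t ≤ t + delay) (harrival : ∀ t, arrival t ≤ t + delay)
    (hdelayed : ∀ t v, HasQualityExponent
      (fun P => ∫ ω, ‖h t v ω - est P (source t) (arrival t) v ω‖ ^ 2 ∂μ) (β v))
    (hα : ∀ v, 3 * d - 2 ≤ (∑ t ∈ Finset.range Tc, α v t) / Tc) (hβ : ∀ v, 2 * d - 1 ≤ β v) :
    AchievableDoF μ h est (fun _ => d) := by
  refine achievableDoF_of_schemes hTc fun ε hε => ?_
  obtain ⟨N, A, hD, ha, htotal⟩ := exists_digitAllocation hTc (fun v => h0 (1 - v))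
    (fun v => hαβ (1 - v)) (fun v => hβ1 (1 - v)) (fun v => hα (1 - v)) (fun v => hβ (1 - v)) hε
  obtain ⟨Z, rfl, hgood⟩ := exists_scheme A hm hli hcur hper hsource harrival hdelayed hD ha
  exact ⟨N, Z, htotal, hgood⟩

end Exponents

section StopAfterCoherence

/-- The last slot of the coherence period of slot `t`. -/
def periodEnd (Tc t : ℕ) : ℕ := t / Tc * Tc + (Tc - 1)

variable {Tc : ℕ}

theorem le_periodEnd (hTc : 0 < Tc) (t : ℕ) : t ≤ periodEnd Tc t := by
  have hmod := Nat.mod_lt t hTc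
  have hdiv := Nat.div_add_mod' t Tc
  unfold periodEnd
  omega

theorem periodEnd_le (Tc t : ℕ) : periodEnd Tc t ≤ t + Tc :=
  add_le_add (Nat.div_mul_le_self t Tc) (Nat.sub_le Tc 1)

theorem periodEnd_div (hTc : 0 < Tc) (t : ℕ) : periodEnd Tc t / Tc = t / Tc := by
  rw [periodEnd, Nat.mul_comm, Nat.mul_add_div hTc, Nat.div_eq_of_lt (Nat.sub_one_lt hTc.ne'),
    add_zero]

variable {Ω : Type*} {M : ℕ}

theorem stopAfterCoherence_self (hTc : 0 < Tc) (est : Feedback Ω M) (P : ℝ) (t : ℕ) (i : Fin 2) :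
    stopAfterCoherence Tc est P t t i = est P t t i :=
  congrArg (est P t · i) (min_eq_left (le_periodEnd hTc t))

variable [MeasurableSpace Ω] {μ : Measure Ω} {h : Channel Ω M} {est : Feedback Ω M}

/-- The channel does not change until the end of its coherence period, so that the current estimate
of that slot is a delayed one for all slots of the period. -/
theorem integral_sub_stopAfterCoherence_periodEnd (hTc : 0 < Tc)
    (hfading : ∀ t t' i, t / Tc = t' / Tc → h t i =ᵐ[μ] h t' i) (P : ℝ) (t : ℕ) (i : Fin 2) :
    ∫ ω, ‖h t i ω - stopAfterCoherence Tc est P (periodEnd Tc t) (periodEnd Tc t) i ω‖ ^ 2 ∂μ =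
      mse μ h est P (periodEnd Tc t) (periodEnd Tc t) i := by
  rw [mse, stopAfterCoherence_self hTc]
  refine integral_congr_ae ?_
  filter_upwards [hfading t (periodEnd Tc t) i (periodEnd_div hTc t).symm] with ω hω
  rw [hω]

theorem map_periodEnd {f : ℕ → ℝ} (hf : Function.Periodic f Tc) (t : ℕ) :
    f (periodEnd Tc t) = f (Tc - 1) := by
  rw [periodEnd, add_comm]
  exact hf.nsmul (t / Tc) (Tc - 1)

theorem le_map_sub_one {f : ℕ → ℝ} (hTc : 0 < Tc) (hf : Function.Periodic f Tc)
    (hmono : ∀ s t, s ≤ t → t < Tc → f s ≤ f t) (t : ℕ) : f t ≤ f (Tc - 1) := by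
  rw [← hf.map_mod_nat t]
  exact hmono _ _ (Nat.le_sub_one_of_lt (Nat.mod_lt t hTc)) (Nat.sub_one_lt hTc.ne')

end StopAfterCoherence

end MisoBC

end

open MisoBC in
theorem corollary7_general {Ω : Type*} [MeasurableSpace Ω] (μ : Measure Ω) [IsProbabilityMeasure μ]
    (M Tc : ℕ) (hTc : 0 < Tc) (h : Channel Ω M) (est : Feedback Ω M) (α : Fin 2 → ℕ → ℝ)
    (hm : ∀ t i, Measurable (h t i))
    (hli : ∀ t, ∀ᵐ ω ∂μ, LinearIndependent ℂ (fun i : Fin 2 => h t i ω))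
    (hfading : ∀ t t' i, t / Tc = t' / Tc → h t i =ᵐ[μ] h t' i)
    (hcur : ∀ t i, HasQualityExponent (fun P => mse μ h est P t t i) (α i t))
    (hper : ∀ i, Function.Periodic (α i) Tc) (h0 : ∀ i t, 0 ≤ α i t) (h1 : ∀ i t, α i t ≤ 1)
    (hmono : ∀ i s t, s ≤ t → t < Tc → α i s ≤ α i t)
    (d : ℝ) (hα : ∀ i, 3 * d - 2 ≤ (∑ t ∈ Finset.range Tc, α i t) / Tc) :
    (∀ β : Fin 2 → ℝ, (∀ i, HasDelayedExponent μ h est i (β i)) →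
      (∀ i, α i (Tc - 1) ≤ β i) → (∀ i, β i ≤ 1) → (∀ i, 2 * d - 1 ≤ β i) →
      AchievableDoF μ h est (fun _ => d)) ∧
    ((∀ i, 2 * d - 1 ≤ α i (Tc - 1)) →
      AchievableDoF μ h (stopAfterCoherence Tc est) (fun _ => d)) := by
  have hlast : ∀ i t, α i t ≤ α i (Tc - 1) := fun i => le_map_sub_one hTc (hper i) (hmono i)
  constructor
  · intro β hβ hαβ hβ1 hdβ
    choose η hη using hβ
    exact achievableDoF_of_exponents hTc hm hli hcur hper h0
      (fun i t => (hlast i t).trans (hαβ i)) hβ1 (fun t => Nat.le_add_right t _)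
      (fun t => le_refl (t + ∑ i, η i))
      (fun t i => hη i _ (Finset.single_le_sum (fun _ _ => Nat.zero_le _) (Finset.mem_univ i)) t)
      hα hdβ
  · intro hdα
    refine achievableDoF_of_exponents hTc hm hli
      (fun t i => by simpa only [mse, stopAfterCoherence_self hTc] using hcur t i) hper h0 hlast
      (fun i => h1 i _) (periodEnd_le Tc) (periodEnd_le Tc) (fun t i => ?_) hα hdα
    simpa only [integral_sub_stopAfterCoherence_periodEnd hTc hfading, map_periodEnd (hper i)]
      using hcur (periodEnd Tc t) i

theorem corollary7 {Ω : Type*} [MeasurableSpace Ω] (μ : MeasureTheory.Measure Ω)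
    [MeasureTheory.IsProbabilityMeasure μ] (M Tc : ℕ) (hM : 2 ≤ M) (hTc : 0 < Tc)
    (h : MisoBC.Channel Ω M) (est : MisoBC.Feedback Ω M) (α : Fin 2 → ℕ → ℝ)
    (hset : MisoBC.PeriodicallyEvolving μ Tc h est α) (d : ℝ) (hd : 0 ≤ d)
    (hα : ∀ i, 3 * d - 2 ≤ (∑ t ∈ Finset.range Tc, α i t) / Tc) :
    (∀ β : Fin 2 → ℝ, (∀ i, MisoBC.HasDelayedExponent μ h est i (β i)) →
      (∀ i, α i (Tc - 1) ≤ β i) → (∀ i, β i ≤ 1) → (∀ i, 2 * d - 1 ≤ β i) →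
      MisoBC.AchievableDoF μ h est (fun _ => d)) ∧
    ((∀ i, 2 * d - 1 ≤ α i (Tc - 1)) →
      MisoBC.AchievableDoF μ h (MisoBC.stopAfterCoherence Tc est) (fun _ => d)) :=
  corollary7_general μ M Tc hTc h est α hset.measurable_channel hset.linearIndependent
    hset.block_fading hset.current_exponent hset.periodic hset.exponent_nonneg
    hset.exponent_le_one hset.exponent_mono d hα
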